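/- Let $\mathbb{H}$ be a field with $\mathbb{Q}\subset\mathbb{H}\subset\mathbb{C}$ and let $A\in\mathbb{H}^{n\times n}$ be nonderogatory, i.e. every complex eigenvalue of $A$ has geometric multiplicity one. Let $p_A=g_1^{d_1}\cdots g_r^{d_r}$, $d_j\ge 1$, be the factorization of the characteristic polynomial of $A$ with $g_j\in\mathbb{H}[\lambda]$ monic, irreducible and pairwise coprime, and put $k_j=\deg g_j$. Let $C_{g_j}$ be the companion matrix of $g_j$ (ones on the superdiagonal, the negatives of the coefficients $a_0,\dots,a_{k_j-1}$ of $g_j$ in the last row), and let $C_j$ be the $d_jk_j\times d_jk_j$ block matrix with $d_j$ diagonal blocks $C_{g_j}$, with $I_{k_j}$ in each block directly above the diagonal, and with zeros elsewhere. Let $p(\lambda)=p_0+p_1\lambda+\dots+p_\ell\lambda^\ell\in\mathbb{H}[\lambda]$. Then there is an invertible $T\in\mathbb{H}^{n\times n}$ with $$A=T^{-1}(C_1\oplus\cdots\oplus C_r)T .\qquad (0)$$ For a square matrix $X_1$ over $\mathbb{H}$ put $K(X_1)=\sum_{m=1}^{\ell}p_m\sum_{i=0}^{m-1}(X_1^T)^i\otimes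 X_1^{m-1-i}$. For every $j$ and every $X_1\in\mathbb{H}^{k_j\times k_j}$ with $p(X_1)=C_{g_j}$ the condition $$\det K(X_1)\neq 0\qquad (1)$$ is equivalent to $$\sum_{m=1}^{\ell}p_m\sum_{i=0}^{m-1}\mu_1^i\mu_2^{m-1-i}\neq 0\quad\text{for all complex eigenvalues }\mu_1,\mu_2\text{ of }X_1 .$$ For blocks $X_1,X_2,\dots$ of the same size $k\times k$ consider the equation $$\sum_{m=1}^{\ell}p_m\sum_{i=0}^{m-1}X_1^{m-1-i}X_2X_1^i=I_k \qquad (2)$$ for $X_2$ and, for $s\ge 3$, the equation for $X_s$ $$K(X_1)\,\mathrm{vec}(X_s)=-\mathrm{vec}\Big(\sum_{m=2}^{\ell}p_m\sum_{i=0}^{m-2}\sum_{\nu=0}^{m-i-2}X_1^{m-i-2-\nu}\,[X_2\ \cdots\ X_{s-1}]\,\widetilde X_1^{\nu}\begin{bmatrix}X_{s-1}\\ \vdots\\ X_2\end{bmatrix}X_1^i\Big),\qquad (3)$$ where $\mathrm{vec}$ stacks columns and $\widetilde X_1$ is the block upper triangular Toeplitz matrix with $s-2$ block rows and first block row $[X_1\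 X_2\ \cdots\ X_{s-2}]$. The following hold. (i) If $p(X)=A$ has a solution $X\in\mathbb{H}^{n\times n}$, then for every root $\lambda$ of every $g_j$ there is $\mu\in\mathbb{H}(\lambda)$ with $p(\mu)=\lambda$. (ii) Conversely, if $p(\mu)=\lambda$ has a solution in $\mathbb{H}(\lambda)$ for every eigenvalue $\lambda$ of $A$, then for each $j$ the equation $p(X_{1,j})=C_{g_j}$ has a solution $X_{1,j}\in\mathbb{H}^{k_j\times k_j}$. For each $j$ and each root $\lambda_j$ of $g_j$, the number of solutions of $p(X_{1,j})=C_{g_j}$ over $\mathbb{H}$ equals the number $m_j\in\{0,1,2,\dots,\infty\}$ of solutions $\mu\in\mathbb{H}(\lambda_j)$ of $p(\mu)=\lambda_j$. (iii) Assume that $p(\mu)=\lambda$ has a solution in $\mathbb{H}(\lambda)$ for every eigenvalue $\lambda$ of $A$, and that for each $j$ with $d_j>1$ some solution of $p(X_{1,j})=C_{g_j}$ over $\mathbb{H}$ satisfies (1). Then there is a choice of $X_{1,j}\in\mathbb{H}^{k_j\times k_j}$ ($j=1,\dots,r$) with $p(X_{1,j})=C_{g_j}$, satisfying (1) whenever $d_j>1$.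 For every such choice there are matrices $X_{s,j}\in\mathbb{H}^{k_j\times k_j}$, $2\le s\le d_j$, such that $X_{2,j}$ is the unique solution of (2) and, for $3\le s\le d_j$, $X_{s,j}$ is the unique solution of (3) (all blocks being taken from the $j$-th family); and for every invertible $T\in\mathbb{H}^{n\times n}$ satisfying (0), the matrix $$X=T^{-1}(Y_1\oplus\cdots\oplus Y_r)T\in\mathbb{H}^{n\times n},$$ where $Y_j$ is the block upper triangular Toeplitz matrix with first block row $[X_{1,j}\ X_{2,j}\ \cdots\ X_{d_j,j}]$, is a solution of $p(X)=A$. (iv) If (1) is satisfied for each $j$ with $d_j>1$ and each solution $X_{1,j}\in\mathbb{H}^{k_j\times k_j}$ of $p(X_{1,j})=C_{g_j}$, then $p(X)=A$ has precisely $m_1m_2\cdots m_r$ solutions $X\in\mathbb{H}^{n\times n}$. (v) Let $X_{s,j}\in\mathbb{H}^{k_j\times k_j}$ ($1\le s\le d_j$, $1\le j\le r$) be such that for each $j$ one has $p(X_{1,j})=C_{g_j}$, equation (2) if $d_j\ge2$, and equation (3) for $3\le s\le d_j$, whether or not (1) holds for $X_{1,j}$. Then for every invertible $T\in\mathbb{H}^{n\times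 n}$ satisfying (0), the matrix $X=T^{-1}(Y_1\oplus\cdots\oplus Y_r)T$ formed as in (iii) is a solution of $p(X)=A$. If moreover (1) fails for $X_{1,j}$ for some $j$ with $d_j>1$, then $p(X)=A$ has infinitely many solutions $X\in\mathbb{H}^{n\times n}$. -/

import Mathlib

open Polynomial
open scoped Kronecker IntermediateField

noncomputable section

namespace PolyMatEq

/-- A square matrix over a subfield `H` of `ℂ` is nonderogatory if every (complex) eigenvalue has
geometric multiplicity one. -/
def Nonderogatory {H : Subfield ℂ} {n : ℕ} (A : Matrix (Fin n) (Fin n) H) : Prop :=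
  ∀ z : ℂ, Module.End.HasEigenvalue (Matrix.toLin' (A.map (algebraMap H ℂ))) z →
    Module.finrank ℂ
      (Module.End.eigenspace (Matrix.toLin' (A.map (algebraMap H ℂ))) z) = 1

section Ring

variable {R : Type*} [CommRing R]

/-- The companion matrix of a monic polynomial: ones on the superdiagonal, and
`-a₀, …, -a_{k-1}` in the last row. -/
def companion (g : R[X]) : Matrix (Fin g.natDegree) (Fin g.natDegree) R :=
  Matrix.of fun i j =>
    if (i : ℕ) + 1 = g.natDegree then -g.coeff j
    else if (j : ℕ) = i + 1 then 1 else 0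

/-- The `d × d` block upper triangular Toeplitz matrix with first block row
`X 1, X 2, …, X d` (blocks are numbered from `1`; the other values of `X` are not used). -/
def blockToeplitz {k : ℕ} (d : ℕ) (X : ℕ → Matrix (Fin k) (Fin k) R) :
    Matrix (Fin d × Fin k) (Fin d × Fin k) R :=
  Matrix.of fun a b =>
    if (a.1 : ℕ) ≤ b.1 then X ((b.1 : ℕ) - a.1 + 1) a.2 b.2 else 0

/-- The companion-Jordan block: `C_g` in the diagonal blocks, the identity in the blocks just above
the diagonal, and zero in all other blocks. -/
def companionJordanBlock (d : ℕ) (g : R[X]) :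
    Matrix (Fin d × Fin g.natDegree) (Fin d × Fin g.natDegree) R :=
  Matrix.of fun a b =>
    if (b.1 : ℕ) = a.1 then companion g a.2 b.2
    else if (b.1 : ℕ) = a.1 + 1 then (1 : Matrix (Fin g.natDegree) (Fin g.natDegree) R) a.2 b.2
    else 0

/-- `Δp(W, Y)(Z) = ∑_{m=1}^ℓ p_m ∑_{i=0}^{m-1} W^{m-1-i} Z Y^i`. -/
def Delta {a b : Type*} [Fintype a] [DecidableEq a] [Fintype b] [DecidableEq b]
    (p : R[X]) (W : Matrix a a R) (Y : Matrix b b R) (Z : Matrix a b R) : Matrix a b R :=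
  ∑ m ∈ Finset.Icc 1 p.natDegree,
    p.coeff m • ∑ i ∈ Finset.range m, W ^ (m - 1 - i) * Z * Y ^ i

/-- The coefficient matrix `∑_{m=1}^ℓ p_m ∑_{i=0}^{m-1} (X₁ᵀ)^i ⊗ X₁^{m-1-i}`. -/
def kronCoeff {k : ℕ} (p : R[X]) (X₁ : Matrix (Fin k) (Fin k) R) :
    Matrix (Fin k × Fin k) (Fin k × Fin k) R :=
  ∑ m ∈ Finset.Icc 1 p.natDegree,
    p.coeff m • ∑ i ∈ Finset.range m, (X₁.transpose ^ i) ⊗ₖ (X₁ ^ (m - 1 - i))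

/-- The determinant condition on the diagonal block `X₁`. -/
def DetCondition {k : ℕ} (p : R[X]) (X₁ : Matrix (Fin k) (Fin k) R) : Prop :=
  (kronCoeff p X₁).det ≠ 0

/-- The block row `[X₂ X₃ ⋯ X_{s-1}]`. -/
def blockRow {k : ℕ} (X : ℕ → Matrix (Fin k) (Fin k) R) (s : ℕ) :
    Matrix (Fin k) (Fin (s - 2) × Fin k) R :=
  Matrix.of fun a b => X ((b.1 : ℕ) + 2) a b.2

/-- The block column with blocks `X_{s-1}, …, X₂` from top to bottom. -/
def blockCol {k : ℕ} (X : ℕ → Matrix (Fin k) (Fin k) R) (s : ℕ) :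
    Matrix (Fin (s - 2) × Fin k) (Fin k) R :=
  Matrix.of fun a b => X (s - 1 - (a.1 : ℕ)) a.2 b

/-- The linear equation for the block `Z = X_s`, given `X₁, …, X_{s-1}`.
For `s = 2` it is `Δp(X₁, X₁)(Z) = I`. For `s ≥ 3` it is
`(∑_m p_m ∑_i (X₁ᵀ)^i ⊗ X₁^{m-1-i}) vec Z = - vec (∑_{m=2}^ℓ p_m ∑_{i=0}^{m-2} ∑_{ν=0}^{m-i-2}
  X₁^{m-i-2-ν} [X₂ ⋯ X_{s-1}] (X̃₁)^ν [X_{s-1}; …; X₂] X₁^i)`, where `X̃₁` is the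
`(s-2) × (s-2)` block upper triangular Toeplitz matrix with first block row `X₁, …, X_{s-2}`.
(The equation is only used for `s ≥ 2`.) -/
def StepEquation {k : ℕ} (p : R[X]) (X : ℕ → Matrix (Fin k) (Fin k) R) (s : ℕ)
    (Z : Matrix (Fin k) (Fin k) R) : Prop :=
  if s = 2 then Delta p (X 1) (X 1) Z = 1
  else
    (kronCoeff p (X 1)).mulVec Z.vec =
      -(∑ m ∈ Finset.Icc 2 p.natDegree, p.coeff m •
          ∑ i ∈ Finset.range (m - 1), ∑ ν ∈ Finset.range (m - 1 - i),
            X 1 ^ (m - 2 - i - ν) * blockRow X s * blockToeplitz (s - 2) X ^ ν *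
              blockCol X s * X 1 ^ i).vec

/-- The equivalence between the index set of a direct sum of `r` block matrices, the `j`-th one
having `d j × d j` blocks of size `k j × k j`, and `{0, …, n-1}`, in the usual order. -/
def indexEquiv {r n : ℕ} (d k : Fin r → ℕ) (h : ∑ j, d j * k j = n) :
    (Σ j : Fin r, Fin (d j) × Fin (k j)) ≃ Fin n :=
  ((Equiv.sigmaCongrRight fun _ => finProdFinEquiv).trans finSigmaFinEquiv).trans (finCongr h)

/-- The direct sum `B₁ ⊕ ⋯ ⊕ B_r` as an `n × n` matrix. -/
def directSum {r n : ℕ} {d k : Fin r → ℕ} (h : ∑ j, d j * k j = n)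
    (B : ∀ j, Matrix (Fin (d j) × Fin (k j)) (Fin (d j) × Fin (k j)) R) :
    Matrix (Fin n) (Fin n) R :=
  Matrix.reindex (indexEquiv d k h) (indexEquiv d k h) (Matrix.blockDiagonal' B)

end Ring

/-- The eigenvalue condition `∑_m p_m ∑_i μ₁^i μ₂^{m-1-i} ≠ 0` for all pairs of complex
eigenvalues of `X₁`. -/
def EigenvalueCondition {H : Subfield ℂ} {k : ℕ} (p : H[X]) (X₁ : Matrix (Fin k) (Fin k) H) :
    Prop :=
  ∀ μ₁ ∈ spectrum ℂ (X₁.map (algebraMap H ℂ)), ∀ μ₂ ∈ spectrum ℂ (X₁.map (algebraMap H ℂ)),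
    ∑ m ∈ Finset.Icc 1 p.natDegree,
      (p.coeff m : ℂ) * ∑ i ∈ Finset.range m, μ₁ ^ i * μ₂ ^ (m - 1 - i) ≠ 0

/-- The set of solutions `μ ∈ H(z)` of the scalar equation `p(μ) = z`. -/
def scalarSolutions {H : Subfield ℂ} (p : H[X]) (z : ℂ) : Set ℂ :=
  {μ | μ ∈ H⟮z⟯ ∧ aeval μ p = z}

/-- If the characteristic polynomial is `∏ g_j^{d_j}`, then `∑ d_j deg g_j = n`. -/
theorem size_eq {K : Type*} [Field K] {n r : ℕ} {A : Matrix (Fin n) (Fin n) K}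
    {g : Fin r → K[X]} {d : Fin r → ℕ} (hg : ∀ j, (g j).Monic)
    (hA : A.charpoly = ∏ j, g j ^ d j) : ∑ j, d j * (g j).natDegree = n := by
  have h := congrArg natDegree hA
  rw [Matrix.charpoly_natDegree_eq_dim, Fintype.card_fin,
    natDegree_prod_of_monic _ _ fun j _ => (hg j).pow _] at h
  rw [h]
  exact Finset.sum_congr rfl fun j _ => ((hg j).natDegree_pow _).symm

end PolyMatEq

end

open PolyMatEq

/-! Nonderogatory means that the minimal polynomial of `A` has full degree, so it equals the
characteristic polynomial `∏ g_j ^ d_j`. Such a matrix has a cyclic vector. Hence it is similar to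
any matrix with the same minimal polynomial, in particular to the sum of companion-Jordan blocks,
and everything commuting with it is a polynomial in it. A solution of `p(X) = A` commutes with `A`,
so it lies in `H[A]`, a copy of `H[x]/(∏ g_j ^ d_j)`.

Existence and counting thereby become commutative algebra. The Chinese remainder theorem splits the
quotient into the rings `H[x]/(g_j ^ d_j)`. Their solutions reduce to `H[x]/(g_j)`, which is `H(z)`
for a root `z` of `g_j`, and lift uniquely by Newton's method when `p'` does not vanish at them. The
determinant condition guarantees this, because `Δp(M, M)` sends the identity to `p'(M)`.

The explicit solutions come from viewing block Toeplitz matrices as truncated power series in a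
central variable `ε` with matrix coefficients. A companion-Jordan block is then `C_g + ε`, and the
equations for the blocks compare coefficients in `p(X₁ + X₂ ε + ⋯) = C_g + ε`; see `coeff_aeval_mk`
and `aeval_blockToeplitz`.

The infinitude claim in (v) concerns an impossible situation: `detCondition_of_delta_eq_one` shows
that solvability of the equation for `X₂` already forces the determinant condition. -/

noncomputable section

namespace PolyMatEq

/-! ### Cyclic vectors, similarity and centralizers -/

section Cyclic

variable {K : Type*} [Field K] {n : Type*} [Fintype n] [DecidableEq n]

/-- Over an infinite field, some vector has the minimal polynomial of the matrix as annihilator. -/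
theorem exists_vector_minpoly_dvd [Infinite K] (M : Matrix n n K) :
    ∃ v : n → K, ∀ q : K[X], (aeval M q).mulVec v = 0 → minpoly K M ∣ q := by
  classical
  set m := minpoly K M with hm
  have hm0 : m ≠ 0 := minpoly.ne_zero (Matrix.isIntegral M)
  let F := (UniqueFactorizationMonoid.normalizedFactors m).toFinset
  -- One kernel for each maximal proper divisor `m / f` of `m`. All are proper subspaces, and
  -- finitely many of these cannot cover the space over an infinite field; `v` is taken outside
  -- their union.
  let s : Finset (Submodule K (n → K)) :=
    F.image fun f => LinearMap.ker (Matrix.toLin' (aeval M (m / f)))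
  have hs : ⊤ ∉ s := by
    intro h
    obtain ⟨f, hf, hker⟩ := Finset.mem_image.mp h
    have hf' := Multiset.mem_toFinset.mp hf
    have hfi := UniqueFactorizationMonoid.irreducible_of_normalized_factor f hf'
    have hfd := UniqueFactorizationMonoid.dvd_of_mem_normalizedFactors hf'
    obtain ⟨c, hc⟩ := hfd
    have hdiv : m / f = c := by
      rw [hc]; exact mul_div_cancel_left₀ c hfi.ne_zero
    rw [LinearMap.ker_eq_top, LinearEquiv.map_eq_zero_iff, hdiv] at hker
    have h1 : m ∣ c := minpoly.dvd K M hker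
    have hc0 : c ≠ 0 := by rintro rfl; exact hm0 (by simpa using hc)
    obtain ⟨e, he⟩ := h1
    have : c * (f * e) = c * 1 := by
      rw [mul_one]
      conv_rhs => rw [he, hc]
      ring
    exact hfi.not_isUnit (IsUnit.of_mul_eq_one _ (mul_left_cancel₀ hc0 this))
  have hne := Subspace.biUnion_ne_univ_of_top_notMem hs
  obtain ⟨v, hv⟩ := (Set.ne_univ_iff_exists_notMem _).mp hne
  refine ⟨v, fun q hq => ?_⟩
  -- By Bézout `h` also annihilates `v`. Were `h` a proper divisor of `m`, it would divide some `m /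
  -- f'`, placing `v` in one of the excluded kernels.
  set h := EuclideanDomain.gcd q m
  have hh : (aeval M h).mulVec v = 0 := by
    have hab : h = _ := EuclideanDomain.gcd_eq_gcd_ab q m
    rw [hab, mul_comm q, mul_comm m, map_add, map_mul, map_mul,
      Matrix.add_mulVec, ← Matrix.mulVec_mulVec, hq, hm, minpoly.aeval]
    simp
  obtain ⟨c, hc⟩ : h ∣ m := EuclideanDomain.gcd_dvd_right q m
  by_cases hcu : IsUnit c
  · have : m ∣ h := by
      rw [hc]; exact (hcu.mul_right_dvd).mpr dvd_rfl
    exact this.trans (EuclideanDomain.gcd_dvd_left q m)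
  · exfalso
    have hc0 : c ≠ 0 := by rintro rfl; exact hm0 (by simpa using hc)
    obtain ⟨f, hfi, hfc⟩ := WfDvdMonoid.exists_irreducible_factor hcu hc0
    obtain ⟨f', hf', hass⟩ := UniqueFactorizationMonoid.exists_mem_normalizedFactors_of_dvd hm0 hfi
      (hfc.trans (hc ▸ dvd_mul_left c h))
    obtain ⟨e, he⟩ := hass.dvd_iff_dvd_left.mp hfc
    have hf'0 : f' ≠ 0 := hass.ne_zero_iff.mp hfi.ne_zero
    have hdiv : m / f' = e * h := by
      rw [hc, he, show h * (f' * e) = f' * (e * h) by ring]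
      exact mul_div_cancel_left₀ _ hf'0
    apply hv
    refine Set.mem_biUnion (Finset.mem_coe.mpr (Finset.mem_image_of_mem _
      (Multiset.mem_toFinset.mpr hf'))) ?_
    rw [SetLike.mem_coe, LinearMap.mem_ker, hdiv, Matrix.toLin'_apply, map_mul,
      ← Matrix.mulVec_mulVec, hh, Matrix.mulVec_zero]

/-- If the minimal polynomial has full degree, the matrix has a cyclic vector. -/
theorem exists_cyclic_vector [Infinite K] {M : Matrix n n K}
    (hM : (minpoly K M).natDegree = Fintype.card n) :
    ∃ v : n → K, (∀ q : K[X], (aeval M q).mulVec v = 0 ↔ minpoly K M ∣ q) ∧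
      ∀ w, ∃ q : K[X], (aeval M q).mulVec v = w := by
  obtain ⟨v, hv⟩ := exists_vector_minpoly_dvd M
  have hiff : ∀ q : K[X], (aeval M q).mulVec v = 0 ↔ minpoly K M ∣ q := by
    refine fun q => ⟨hv q, ?_⟩
    rintro ⟨c, rfl⟩
    simp [minpoly.aeval]
  refine ⟨v, hiff, ?_⟩
  let ψ : K[X] →ₗ[K] (n → K) :=
    (LinearMap.applyₗ v).comp (Matrix.toLin'.toLinearMap.comp (aeval M).toLinearMap)
  have hψ : ∀ q, ψ q = (aeval M q).mulVec v := fun q => by simp [ψ]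
  -- On polynomials of degree below the matrix size the evaluation is injective, so it is surjective
  -- by dimension.
  let φ := ψ.comp (degreeLT K (Fintype.card n)).subtype
  have hinj : Function.Injective φ := by
    rw [← LinearMap.ker_eq_bot, LinearMap.ker_eq_bot']
    rintro ⟨q, hq⟩ h0
    have h1 : minpoly K M ∣ q := (hiff q).mp (by rw [← hψ]; exact h0)
    have : q = 0 := by
      by_contra hq0
      have h2 := natDegree_le_of_dvd h1 hq0
      rw [mem_degreeLT, ← natDegree_lt_iff_degree_lt hq0] at hq
      omega
    simp [this]
  have hfd : FiniteDimensional K (degreeLT K (Fintype.card n)) :=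
    (degreeLTEquiv K (Fintype.card n)).symm.finiteDimensional
  have hfr : Module.finrank K (degreeLT K (Fintype.card n)) = Module.finrank K (n → K) := by
    rw [(degreeLTEquiv K (Fintype.card n)).finrank_eq]; simp
  have hsurj := (LinearMap.injective_iff_surjective_of_finrank_eq_finrank hfr).mp hinj
  intro w
  obtain ⟨q, hq⟩ := hsurj w
  exact ⟨q, by rw [← hψ]; exact hq⟩

/-- The centralizer of a matrix with a cyclic vector consists of its polynomials. -/
theorem exists_aeval_eq_of_commute [Infinite K] {M X : Matrix n n K}
    (hM : (minpoly K M).natDegree = Fintype.card n) (hX : Commute X M) :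
    ∃ q : K[X], aeval M q = X := by
  obtain ⟨v, -, hv⟩ := exists_cyclic_vector hM
  obtain ⟨q, hq⟩ := hv (X.mulVec v)
  -- `X` and `q(M)` agree on `v` and commute with `M`, so they agree on every `h(M) v`, hence
  -- everywhere.
  refine ⟨q, Matrix.toLin'.injective (LinearMap.ext fun w => ?_)⟩
  obtain ⟨h, rfl⟩ := hv w
  have hc : Commute X (aeval M h) := by
    refine h.induction_on (motive := fun h => Commute X (aeval M h)) ?_ ?_ ?_
    · intro a; rw [aeval_C]; exact (Algebra.commutes a X).symm
    · intro a b ha hb; rw [map_add]; exact ha.add_right hb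
    · intro k a h; rw [map_mul, map_pow, aeval_X, aeval_C]
      exact Commute.mul_right (Algebra.commutes a X).symm (hX.pow_right _)
  simp only [Matrix.toLin'_apply, Matrix.mulVec_mulVec]
  rw [← map_mul, mul_comm, map_mul, ← Matrix.mulVec_mulVec, hq, Matrix.mulVec_mulVec, hc.eq]

/-- Two matrices with the same minimal polynomial of full degree are similar. -/
theorem exists_similar_of_minpoly_eq [Infinite K] {M N : Matrix n n K}
    (hM : (minpoly K M).natDegree = Fintype.card n) (hMN : minpoly K M = minpoly K N) :
    ∃ T : Matrix n n K, IsUnit T ∧ M = T⁻¹ * N * T := by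
  obtain ⟨v, hv0, hv⟩ := exists_cyclic_vector hM
  obtain ⟨w, hw0, hw⟩ := exists_cyclic_vector (hMN ▸ hM)
  let ψ (M : Matrix n n K) (v : n → K) : K[X] →ₗ[K] (n → K) :=
    (LinearMap.applyₗ v).comp (Matrix.toLin'.toLinearMap.comp (aeval M).toLinearMap)
  have hψ : ∀ M v (q : K[X]), ψ M v q = (aeval M q).mulVec v := fun M v q => by simp [ψ]
  have hker : LinearMap.ker (ψ M v) = LinearMap.ker (ψ N w) := by
    ext q
    rw [LinearMap.mem_ker, LinearMap.mem_ker, hψ, hψ, hv0, hw0, hMN]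
  have hsv : Function.Surjective (ψ M v) := fun u => by simpa [hψ] using hv u
  have hsw : Function.Surjective (ψ N w) := fun u => by simpa [hψ] using hw u
  -- The map `q(M) v ↦ q(N) w`: both spaces are the quotient of `K[X]` by the same annihilator, and
  -- multiplication by `X` becomes `M` and `N` respectively.
  let e : (n → K) ≃ₗ[K] (n → K) :=
    ((ψ M v).quotKerEquivOfSurjective hsv).symm.trans
      ((Submodule.quotEquivOfEq _ _ hker).trans ((ψ N w).quotKerEquivOfSurjective hsw))
  have he : ∀ q : K[X], e ((aeval M q).mulVec v) = (aeval N q).mulVec w := by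
    intro q
    have h1 : ((ψ M v).quotKerEquivOfSurjective hsv).symm (ψ M v q) = Submodule.Quotient.mk q := by
      rw [LinearEquiv.symm_apply_eq]; rfl
    rw [← hψ, ← hψ]
    simp only [e, LinearEquiv.trans_apply, h1]
    rfl
  let T := LinearMap.toMatrix' e.toLinearMap
  have hT : ∀ u, T.mulVec u = e u := fun u => by
    rw [← Matrix.toLin'_apply, Matrix.toLin'_toMatrix']; rfl
  have hTu : IsUnit T := by
    refine IsUnit.of_mul_eq_one (LinearMap.toMatrix' e.symm.toLinearMap) ?_
    rw [← LinearMap.toMatrix'_comp]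
    simp
  have hcomm : T * M = N * T := by
    refine Matrix.toLin'.injective (LinearMap.ext fun u => ?_)
    obtain ⟨q, rfl⟩ := hv u
    simp only [Matrix.toLin'_apply]
    rw [← Matrix.mulVec_mulVec, ← Matrix.mulVec_mulVec, hT, hT, he]
    have h1 := he (X * q)
    rw [map_mul, aeval_X, map_mul, aeval_X, ← Matrix.mulVec_mulVec, ← Matrix.mulVec_mulVec] at h1
    exact h1
  refine ⟨T, hTu, ?_⟩
  rw [mul_assoc, ← hcomm, ← mul_assoc,
    Matrix.nonsing_inv_mul _ ((Matrix.isUnit_iff_isUnit_det _).mp hTu), one_mul]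

end Cyclic

/-! ### Nonderogatory matrices have a minimal polynomial of full degree -/

theorem finrank_ker_mul_le {K V : Type*} [Field K] [AddCommGroup V] [Module K V]
    [FiniteDimensional K V] (a b : Module.End K V) :
    Module.finrank K (LinearMap.ker (a * b)) ≤
      Module.finrank K (LinearMap.ker a) + Module.finrank K (LinearMap.ker b) := by
  let φ : LinearMap.ker (a * b) →ₗ[K] V := b.domRestrict (LinearMap.ker (a * b))
  rw [← φ.finrank_range_add_finrank_ker]
  refine add_le_add (Submodule.finrank_mono ?_) ?_
  · rintro _ ⟨x, rfl⟩
    exact x.2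
  · let ι : LinearMap.ker φ →ₗ[K] LinearMap.ker b :=
      LinearMap.codRestrict _ ((LinearMap.ker (a * b)).subtype.comp (LinearMap.ker φ).subtype)
        fun x => x.2
    refine LinearMap.finrank_le_finrank_of_injective (f := ι) fun x y h => ?_
    exact Subtype.ext (Subtype.ext (congrArg (fun u : LinearMap.ker b => (u : V)) h))

/-- If all eigenspaces of an endomorphism are at most one-dimensional, the kernel of a product of
`s.card` linear factors has dimension at most `s.card`. -/
theorem finrank_ker_aeval_prod_le {K V : Type*} [Field K] [AddCommGroup V] [Module K V]
    [FiniteDimensional K V] (f : Module.End K V)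
    (hf : ∀ z, Module.finrank K (f.eigenspace z) ≤ 1) (s : Multiset K) :
    Module.finrank K (LinearMap.ker (aeval f (s.map fun z => X - C z).prod)) ≤ s.card := by
  induction s using Multiset.induction_on with
  | empty =>
    rw [Multiset.map_zero, Multiset.prod_zero, map_one, Multiset.card_zero,
      LinearMap.ker_eq_bot.mpr (fun _ _ h => h), finrank_bot]
  | cons z s ih =>
    rw [Multiset.map_cons, Multiset.prod_cons, map_mul, Multiset.card_cons, add_comm]
    refine (finrank_ker_mul_le _ _).trans (add_le_add ?_ ih)
    have h := hf z
    rwa [Module.End.eigenspace_def, ← show aeval f (X - C z) = f - z • 1 by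
      simp [Algebra.algebraMap_eq_smul_one]] at h

/-- Over `ℂ` the minimal polynomial splits into linear factors, each contributing at most one
dimension to the kernel of the product. That product is zero at `A`, so its kernel has dimension `n`
and there are at least `n` factors. -/
theorem Nonderogatory.natDegree_minpoly {H : Subfield ℂ} {n : ℕ} {A : Matrix (Fin n) (Fin n) H}
    (hA : Nonderogatory A) : (minpoly H A).natDegree = n := by
  apply le_antisymm
  · have := natDegree_le_of_dvd (Matrix.minpoly_dvd_charpoly A) A.charpoly_monic.ne_zero
    rwa [Matrix.charpoly_natDegree_eq_dim, Fintype.card_fin] at this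
  · set f : Module.End ℂ (Fin n → ℂ) := Matrix.toLin' (A.map (algebraMap H ℂ))
    have hf : ∀ z, Module.finrank ℂ (Module.End.eigenspace f z) ≤ 1 := by
      intro z
      by_cases h : Module.End.HasEigenvalue f z
      · exact (hA z h).le
      · have h : Module.End.eigenspace f z = ⊥ := not_not.mp h
        rw [h, finrank_bot]
        exact zero_le_one
    set q := (minpoly H A).map (algebraMap H ℂ)
    have hq : q = (q.roots.map fun z => X - C z).prod :=
      (IsAlgClosed.splits q).eq_prod_roots_of_monic ((minpoly.monic (Matrix.isIntegral A)).map _)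
    have h0 : aeval f q = 0 := by
      have h1 : aeval ((Algebra.ofId H ℂ).mapMatrix A) (minpoly H A) = 0 := by
        rw [aeval_algHom_apply, minpoly.aeval, map_zero]
      have h2 : aeval (Matrix.toLinAlgEquiv' ((Algebra.ofId H ℂ).mapMatrix A)) q = 0 := by
        rw [aeval_algHom_apply, aeval_map_algebraMap, h1, map_zero]
      exact h2
    have h3 := finrank_ker_aeval_prod_le f hf q.roots
    rw [← hq, h0, LinearMap.ker_zero, finrank_top, Module.finrank_fin_fun] at h3
    exact h3.trans ((card_roots' q).trans natDegree_map_le)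

/-! ### Block Toeplitz matrices as truncated power series -/

section Toeplitz

variable {R : Type*} [CommRing R] {k : ℕ}

theorem toeplitz_mul_apply {d : ℕ} (F G : PowerSeries (Matrix (Fin k) (Fin k) R))
    (a b : Fin d × Fin k) :
    (if (a.1 : ℕ) ≤ b.1 then PowerSeries.coeff ((b.1 : ℕ) - a.1) (F * G) a.2 b.2 else 0) =
      ∑ c : Fin d × Fin k,
        (if (a.1 : ℕ) ≤ c.1 then PowerSeries.coeff ((c.1 : ℕ) - a.1) F a.2 c.2 else 0) *
        (if (c.1 : ℕ) ≤ b.1 then PowerSeries.coeff ((b.1 : ℕ) - c.1) G c.2 b.2 else 0) := by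
  obtain ⟨⟨a, ha⟩, i⟩ := a
  obtain ⟨⟨b, hb⟩, j⟩ := b
  simp only
  let f : ℕ → R := fun c => if a ≤ c ∧ c ≤ b then
    (PowerSeries.coeff (c - a) F * PowerSeries.coeff (b - c) G) i j else 0
  have h1 : ∀ c : Fin d, ∑ l : Fin k,
      (if a ≤ (c : ℕ) then PowerSeries.coeff ((c : ℕ) - a) F i l else 0) *
        (if (c : ℕ) ≤ b then PowerSeries.coeff (b - (c : ℕ)) G l j else 0) =
      f c := by
    intro c
    simp only [f]
    by_cases h : a ≤ (c : ℕ) <;> by_cases h' : (c : ℕ) ≤ b <;> simp [h, h', Matrix.mul_apply]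
  rw [Fintype.sum_prod_type]
  simp only
  rw [Finset.sum_congr rfl fun c _ => h1 c, Fin.sum_univ_eq_sum_range f d, ← Finset.sum_filter]
  split_ifs with hab
  · rw [PowerSeries.coeff_mul, Matrix.sum_apply]
    symm
    refine Finset.sum_nbij' (fun c => (c - a, b - c)) (fun x => a + x.1) ?_ ?_ ?_ ?_ ?_
    · intro c hc
      simp only [Finset.mem_filter, Finset.mem_range] at hc
      rw [Finset.HasAntidiagonal.mem_antidiagonal]
      omega
    · intro x hx
      rw [Finset.HasAntidiagonal.mem_antidiagonal] at hx
      simp only [Finset.mem_filter, Finset.mem_range]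
      omega
    · intro c hc
      simp only [Finset.mem_filter, Finset.mem_range] at hc ⊢
      omega
    · intro x hx
      rw [Finset.HasAntidiagonal.mem_antidiagonal] at hx
      ext <;> simp only <;> omega
    · intro c _
      rfl
  · symm
    refine Finset.sum_eq_zero fun c hc => ?_
    simp only [Finset.mem_filter] at hc
    omega

/-- The block upper triangular Toeplitz matrix with first block row the first `d` coefficients of a
power series with matrix coefficients. -/
def toeplitz (d : ℕ) : PowerSeries (Matrix (Fin k) (Fin k) R) →ₐ[R]
    Matrix (Fin d × Fin k) (Fin d × Fin k) R :=
  AlgHom.ofLinearMap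
    { toFun := fun F => Matrix.of fun a b =>
        if (a.1 : ℕ) ≤ b.1 then PowerSeries.coeff ((b.1 : ℕ) - a.1) F a.2 b.2 else 0
      map_add' := fun F G => by
        ext a b
        simp only [Matrix.of_apply, Matrix.add_apply, map_add]
        split_ifs <;> simp
      map_smul' := fun r F => by
        ext a b
        simp }
    (by
      ext ⟨a, i⟩ ⟨b, j⟩
      simp only [LinearMap.coe_mk, AddHom.coe_mk, Matrix.of_apply, Matrix.one_apply,
        PowerSeries.coeff_one, Prod.mk.injEq, Fin.ext_iff]
      by_cases h : (a : ℕ) ≤ b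
      · by_cases h' : (b : ℕ) - a = 0
        · have : (a : ℕ) = b := by omega
          simp [this, Matrix.one_apply, Fin.ext_iff]
        · have : (a : ℕ) ≠ b := by omega
          simp [h', this]
      · have : (a : ℕ) ≠ b := by omega
        simp [h, this])
    (by
      intro F G
      ext a b
      simp only [LinearMap.coe_mk, AddHom.coe_mk, Matrix.of_apply, Matrix.mul_apply]
      exact toeplitz_mul_apply F G a b)

theorem toeplitz_apply (d : ℕ) (F : PowerSeries (Matrix (Fin k) (Fin k) R))
    (a b : Fin d × Fin k) : toeplitz d F a b =
      if (a.1 : ℕ) ≤ b.1 then PowerSeries.coeff ((b.1 : ℕ) - a.1) F a.2 b.2 else 0 :=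
  rfl

theorem toeplitz_eq_iff {d : ℕ} {F G : PowerSeries (Matrix (Fin k) (Fin k) R)} :
    toeplitz d F = toeplitz d G ↔ ∀ i < d, PowerSeries.coeff i F = PowerSeries.coeff i G := by
  refine ⟨fun h i hi => ?_, fun h => ?_⟩
  · ext a b
    have := congrFun (congrFun h (⟨0, by omega⟩, a)) (⟨i, hi⟩, b)
    simpa [toeplitz_apply] using this
  · ext a b
    rw [toeplitz_apply, toeplitz_apply, h _ (by have := b.1.2; omega)]

theorem blockToeplitz_eq_toeplitz (d : ℕ) (X : ℕ → Matrix (Fin k) (Fin k) R) :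
    blockToeplitz d X = toeplitz d (PowerSeries.mk fun n => X (n + 1)) := by
  ext a b
  rw [toeplitz_apply, PowerSeries.coeff_mk]
  rfl

theorem companionJordanBlock_eq_toeplitz (d : ℕ) (g : R[X]) :
    companionJordanBlock d g =
      toeplitz d (PowerSeries.C (companion g) + PowerSeries.X) := by
  ext ⟨a, i⟩ ⟨b, j⟩
  rw [toeplitz_apply, map_add, PowerSeries.coeff_C, PowerSeries.coeff_X]
  simp only [companionJordanBlock, Matrix.of_apply]
  by_cases h : (b : ℕ) = a
  · simp [h]
  · by_cases h' : (b : ℕ) = a + 1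
    · simp [h']
    · by_cases h'' : (a : ℕ) ≤ b
      · have h3 : (b : ℕ) - a ≠ 0 := by omega
        have h4 : (b : ℕ) - a ≠ 1 := by omega
        simp [h, h', h'', h3, h4]
      · simp [h, h', h'']

/-- The sum telescopes without commutativity. The mirrored version below puts `F` on the left;
applying that one first and this one to its inner powers leaves `F` only in the middle of the second
order terms. -/
theorem pow_eq_add_sum_left {S : Type*} [Ring S] (F X : S) (m : ℕ) :
    F ^ m = X ^ m + ∑ i ∈ Finset.range m, X ^ (m - 1 - i) * (F - X) * F ^ i := by
  induction m with
  | zero => simp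
  | succ m ih =>
    have h : ∀ i ∈ Finset.range m, X ^ (m + 1 - 1 - i) * (F - X) * F ^ i =
        X * (X ^ (m - 1 - i) * (F - X) * F ^ i) := by
      intro i hi
      rw [Finset.mem_range] at hi
      rw [show m + 1 - 1 - i = (m - 1 - i) + 1 by omega, pow_succ']
      simp only [mul_assoc]
    rw [Finset.sum_range_succ, Finset.sum_congr rfl h, ← Finset.mul_sum,
      ← sub_eq_iff_eq_add'.mpr ih]
    simp only [add_tsub_cancel_right, Nat.sub_self, pow_zero, one_mul, pow_succ' F, pow_succ' X]
    noncomm_ring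

theorem pow_eq_add_sum_right {S : Type*} [Ring S] (F X : S) (m : ℕ) :
    F ^ m = X ^ m + ∑ i ∈ Finset.range m, F ^ (m - 1 - i) * (F - X) * X ^ i := by
  induction m with
  | zero => simp
  | succ m ih =>
    have h : ∀ i ∈ Finset.range m, F ^ (m + 1 - 1 - i) * (F - X) * X ^ i =
        F * (F ^ (m - 1 - i) * (F - X) * X ^ i) := by
      intro i hi
      rw [Finset.mem_range] at hi
      rw [show m + 1 - 1 - i = (m - 1 - i) + 1 by omega, pow_succ']
      simp only [mul_assoc]
    rw [Finset.sum_range_succ, Finset.sum_congr rfl h, ← Finset.mul_sum,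
      ← sub_eq_iff_eq_add'.mpr ih]
    simp only [add_tsub_cancel_right, Nat.sub_self, pow_zero, one_mul, pow_succ' F, pow_succ' X]
    noncomm_ring

/-- Second order expansion of a power in a noncommutative ring. -/
theorem pow_eq_add_sum_add_sum {S : Type*} [Ring S] (F X : S) (m : ℕ) :
    F ^ m = X ^ m + ∑ i ∈ Finset.range m, X ^ (m - 1 - i) * (F - X) * X ^ i +
      ∑ i ∈ Finset.range (m - 1), ∑ ν ∈ Finset.range (m - 1 - i),
        X ^ (m - 2 - i - ν) * (F - X) * F ^ ν * (F - X) * X ^ i := by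
  have h2 : ∑ i ∈ Finset.range (m - 1), ∑ ν ∈ Finset.range (m - 1 - i),
      X ^ (m - 2 - i - ν) * (F - X) * F ^ ν * (F - X) * X ^ i =
      ∑ i ∈ Finset.range m, ∑ ν ∈ Finset.range (m - 1 - i),
        X ^ (m - 2 - i - ν) * (F - X) * F ^ ν * (F - X) * X ^ i := by
    rcases m with _ | m
    · rfl
    · rw [Finset.sum_range_succ]
      simp
  rw [h2, add_assoc, ← Finset.sum_add_distrib]
  conv_lhs => rw [pow_eq_add_sum_right F X m]
  congr 1
  refine Finset.sum_congr rfl fun i _ => ?_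
  rw [pow_eq_add_sum_left F X (m - 1 - i), add_mul, add_mul, Finset.sum_mul, Finset.sum_mul]
  congr 1
  refine Finset.sum_congr rfl fun ν _ => ?_
  rw [show m - 1 - i - 1 - ν = m - 2 - i - ν by omega]

/-- The two central variables lower the degree from `s - 1` to `s - 3`, which is the top right block
of a product of Toeplitz matrices with `s - 2` block rows; `blockRow` and `blockCol` are the first
block row and last block column of the outer factors. For `s = 2` both sides vanish. -/
theorem blockRow_mul_toeplitz_mul_blockCol (X : ℕ → Matrix (Fin k) (Fin k) R) {s : ℕ} (hs : 2 ≤ s)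
    (Q : PowerSeries (Matrix (Fin k) (Fin k) R)) :
    blockRow X s * toeplitz (s - 2) Q * blockCol X s =
      PowerSeries.coeff (s - 1) ((PowerSeries.X * PowerSeries.mk fun n => X (n + 2)) * Q *
        (PowerSeries.X * PowerSeries.mk fun n => X (n + 2))) := by
  set G : PowerSeries (Matrix (Fin k) (Fin k) R) := PowerSeries.mk fun n => X (n + 2)
  have hG : PowerSeries.X * G * Q * (PowerSeries.X * G) =
      PowerSeries.X * (PowerSeries.X * (G * Q * G)) := by
    rw [mul_assoc PowerSeries.X G Q, mul_assoc PowerSeries.X (G * Q), ← mul_assoc (G * Q),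
      (PowerSeries.commute_X (G * Q)).eq, mul_assoc PowerSeries.X (G * Q)]
  rw [hG]
  obtain rfl | ⟨e, rfl⟩ : s = 2 ∨ ∃ e, s = e + 3 := by
    rcases Nat.lt_or_ge s 3 with h | h
    · left; omega
    · right; exact ⟨s - 3, by omega⟩
  · rw [show 2 - 1 = 0 + 1 by rfl, PowerSeries.coeff_succ_X_mul, PowerSeries.coeff_zero_X_mul]
    ext a b
    simp [Matrix.mul_apply]
  · rw [show e + 3 - 1 = e + 1 + 1 by rfl, PowerSeries.coeff_succ_X_mul,
      PowerSeries.coeff_succ_X_mul]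
    ext i j
    have hrow : ∀ b, blockRow X (e + 3) i b =
        toeplitz (e + 3 - 2) G (⟨0, by omega⟩, i) b := by
      intro b
      simp [toeplitz_apply, blockRow, G]
    have hcol : ∀ a, blockCol X (e + 3) a j =
        toeplitz (e + 3 - 2) G a (⟨e, by omega⟩, j) := by
      intro a
      have ha : (a.1 : ℕ) ≤ e := by have := a.1.2; omega
      simp only [toeplitz_apply, blockCol, G, Matrix.of_apply, if_pos ha, PowerSeries.coeff_mk]
      rw [show e + 3 - 1 - (a.1 : ℕ) = e - a.1 + 2 by omega]
    have h : PowerSeries.coeff e (G * Q * G) i j =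
        toeplitz (e + 3 - 2) (G * Q * G) (⟨0, by omega⟩, i) (⟨e, by omega⟩, j) := by
      simp [toeplitz_apply]
    rw [h, map_mul, map_mul, Matrix.mul_apply, Matrix.mul_apply]
    refine Finset.sum_congr rfl fun c _ => ?_
    rw [hcol, Matrix.mul_apply, Matrix.mul_apply]
    simp_rw [hrow]

/-- The part of the `s`-th coefficient of `p(X₁ + X₂ ε + ⋯)` which does not involve `X_s`. -/
def stepRemainder (p : R[X]) (X : ℕ → Matrix (Fin k) (Fin k) R) (s : ℕ) :
    Matrix (Fin k) (Fin k) R :=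
  ∑ m ∈ Finset.Icc 2 p.natDegree, p.coeff m •
    ∑ i ∈ Finset.range (m - 1), ∑ ν ∈ Finset.range (m - 1 - i),
      X 1 ^ (m - 2 - i - ν) * blockRow X s * blockToeplitz (s - 2) X ^ ν *
        blockCol X s * X 1 ^ i

theorem stepRemainder_two (p : R[X]) (X : ℕ → Matrix (Fin k) (Fin k) R) :
    stepRemainder p X 2 = 0 := by
  refine Finset.sum_eq_zero fun m _ => ?_
  rw [Finset.sum_eq_zero, smul_zero]
  refine fun i _ => Finset.sum_eq_zero fun ν _ => ?_
  rw [show blockRow X 2 = 0 by ext a b; exact b.1.elim0]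
  simp

/-- Expand each power to second order around the constant term `X 1`. The linear part contributes `X
s`; each second order term has two factors without constant term, so in degree `s - 1` it involves
only earlier blocks. Block `X s` is the coefficient of degree `s - 1`. -/
theorem coeff_aeval_mk (p : R[X]) (X : ℕ → Matrix (Fin k) (Fin k) R) {s : ℕ} (hs : 2 ≤ s) :
    PowerSeries.coeff (s - 1) (aeval (PowerSeries.mk fun n => X (n + 1)) p) =
      Delta p (X 1) (X 1) (X s) + stepRemainder p X s := by
  set F : PowerSeries (Matrix (Fin k) (Fin k) R) := PowerSeries.mk fun n => X (n + 1)
  set c : PowerSeries (Matrix (Fin k) (Fin k) R) := PowerSeries.C (X 1)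
  have hF : F - c = PowerSeries.X * PowerSeries.mk fun n => X (n + 2) := by
    ext1 n
    rcases n with _ | n
    · simp [F, c]
    · simp [F, c, PowerSeries.coeff_succ_X_mul]
  have hs1 : s - 1 ≠ 0 := by omega
  have hF1 : PowerSeries.coeff (s - 1) (F - c) = X s := by
    rw [map_sub, PowerSeries.coeff_C, if_neg hs1, PowerSeries.coeff_mk, sub_zero,
      show s - 1 + 1 = s by omega]
  have hpow : ∀ m, m ≠ 0 → PowerSeries.coeff (s - 1) (F ^ m) =
      ∑ i ∈ Finset.range m, X 1 ^ (m - 1 - i) * X s * X 1 ^ i +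
      ∑ i ∈ Finset.range (m - 1), ∑ ν ∈ Finset.range (m - 1 - i),
        X 1 ^ (m - 2 - i - ν) * blockRow X s * blockToeplitz (s - 2) X ^ ν *
          blockCol X s * X 1 ^ i := by
    intro m hm
    rw [pow_eq_add_sum_add_sum F c m, map_add, map_add, map_sum, map_sum, ← map_pow,
      PowerSeries.coeff_C, if_neg hs1, zero_add]
    congr 1
    · refine Finset.sum_congr rfl fun i _ => ?_
      rw [← map_pow, ← map_pow, PowerSeries.coeff_mul_C, PowerSeries.coeff_C_mul, hF1]
    · refine Finset.sum_congr rfl fun i _ => ?_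
      rw [map_sum]
      refine Finset.sum_congr rfl fun ν _ => ?_
      rw [← map_pow, ← map_pow, PowerSeries.coeff_mul_C, mul_assoc (PowerSeries.C _),
        mul_assoc (PowerSeries.C _), PowerSeries.coeff_C_mul, hF,
        ← blockRow_mul_toeplitz_mul_blockCol X hs, map_pow, ← blockToeplitz_eq_toeplitz]
      simp only [Matrix.mul_assoc]
  rw [aeval_eq_sum_range, map_sum, Finset.range_eq_Ico, Finset.sum_eq_sum_Ico_succ_bot (by omega)]
  have h0 : PowerSeries.coeff (s - 1) (p.coeff 0 • F ^ 0) = 0 := by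
    rw [pow_zero, PowerSeries.coeff_smul, PowerSeries.coeff_one, if_neg hs1, smul_zero]
  rw [h0, zero_add, show Finset.Ico (0 + 1) (p.natDegree + 1) = Finset.Icc 1 p.natDegree by
    ext; simp, Delta, stepRemainder]
  have h2 : ∀ f : ℕ → Matrix (Fin k) (Fin k) R, f 1 = 0 →
      ∑ m ∈ Finset.Icc 2 p.natDegree, f m = ∑ m ∈ Finset.Icc 1 p.natDegree, f m := by
    intro f hf
    refine Finset.sum_subset (fun m hm => ?_) fun m hm hm' => ?_
    · rw [Finset.mem_Icc] at *; omega
    · rw [Finset.mem_Icc] at *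
      rw [show m = 1 by omega, hf]
  rw [h2 _ (by simp), ← Finset.sum_add_distrib]
  refine Finset.sum_congr rfl fun m hm => ?_
  rw [Finset.mem_Icc] at hm
  rw [PowerSeries.coeff_smul, hpow m (by omega), smul_add]

theorem kronCoeff_mulVec_vec (p : R[X]) (X₁ Z : Matrix (Fin k) (Fin k) R) :
    (kronCoeff p X₁).mulVec Z.vec = (Delta p X₁ X₁ Z).vec := by
  rw [kronCoeff, Delta, Matrix.sum_mulVec, Matrix.vec_sum]
  refine Finset.sum_congr rfl fun m _ => ?_
  rw [Matrix.smul_mulVec, Matrix.sum_mulVec, Matrix.vec_smul, Matrix.vec_sum]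
  congr 1
  refine Finset.sum_congr rfl fun i _ => ?_
  rw [← Matrix.transpose_pow, Matrix.kronecker_mulVec_vec, Matrix.transpose_transpose]

theorem stepEquation_iff (p : R[X]) (X : ℕ → Matrix (Fin k) (Fin k) R) {s : ℕ} (hs : 2 ≤ s)
    (Z : Matrix (Fin k) (Fin k) R) : StepEquation p X s Z ↔
      Delta p (X 1) (X 1) Z = (if s = 2 then 1 else 0) - stepRemainder p X s := by
  rw [StepEquation]
  split_ifs with h
  · subst h
    rw [stepRemainder_two, sub_zero]
  · rw [kronCoeff_mulVec_vec, zero_sub, ← Matrix.vec_inj, Matrix.vec_neg]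
    rfl

/-- The step equations express that `p` maps a block Toeplitz matrix to a companion-Jordan block. -/
theorem aeval_blockToeplitz {p g : R[X]} {d : ℕ}
    {X : ℕ → Matrix (Fin g.natDegree) (Fin g.natDegree) R}
    (h1 : aeval (X 1) p = companion g)
    (hX : ∀ s, 2 ≤ s → s ≤ d → StepEquation p X s (X s)) :
    aeval (blockToeplitz d X) p = companionJordanBlock d g := by
  rw [blockToeplitz_eq_toeplitz, companionJordanBlock_eq_toeplitz, aeval_algHom_apply,
    toeplitz_eq_iff]
  intro i hi
  rcases i with _ | i
  · have : PowerSeries.coeff 0 (aeval (PowerSeries.mk fun n => X (n + 1)) p) = aeval (X 1) p := by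
      simp [aeval_eq_sum_range, map_sum]
    rw [this, h1]
    simp
  · have h := (stepEquation_iff p X (by omega) _).mp (hX (i + 2) (by omega) (by omega))
    rw [show i + 1 = i + 2 - 1 by omega, coeff_aeval_mk p X (by omega), h, sub_add_cancel]
    simp [PowerSeries.coeff_X]

/-- Makes the step equations recursive: choosing a later block leaves the earlier equations
unchanged. -/
theorem stepRemainder_congr (p : R[X]) {X X' : ℕ → Matrix (Fin k) (Fin k) R} {s : ℕ} (hs : 2 ≤ s)
    (h : ∀ t, 1 ≤ t → t < s → X t = X' t) : stepRemainder p X s = stepRemainder p X' s := by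
  have hrow : blockRow X s = blockRow X' s := by
    ext a b
    have := b.1.2
    simp only [blockRow, Matrix.of_apply]
    rw [h _ (by omega) (by omega)]
  have hcol : blockCol X s = blockCol X' s := by
    ext a b
    have := a.1.2
    simp only [blockCol, Matrix.of_apply]
    rw [h _ (by omega) (by omega)]
  have htoe : blockToeplitz (s - 2) X = blockToeplitz (s - 2) X' := by
    ext a b
    have := b.1.2
    simp only [blockToeplitz, Matrix.of_apply]
    rw [h _ (by omega) (by omega)]
  rw [stepRemainder, stepRemainder, hrow, hcol, htoe, h 1 le_rfl (by omega)]

end Toeplitz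

/-! ### Recursive solution of the step equations -/

section Step

variable {K : Type*} [Field K] {k : ℕ}

theorem DetCondition.delta_existsUnique {p : K[X]} {X₁ : Matrix (Fin k) (Fin k) K}
    (h : DetCondition p X₁) (B : Matrix (Fin k) (Fin k) K) : ∃! Z, Delta p X₁ X₁ Z = B := by
  have hu : IsUnit (kronCoeff p X₁) :=
    (Matrix.isUnit_iff_isUnit_det _).mpr (isUnit_iff_ne_zero.mpr h)
  have hb : Function.Bijective fun Z : Matrix (Fin k) (Fin k) K =>
      (kronCoeff p X₁).mulVec Z.vec :=
    Function.Bijective.comp (g := (kronCoeff p X₁).mulVec)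
      ⟨Matrix.mulVec_injective_iff_isUnit.mpr hu, Matrix.mulVec_surjective_iff_isUnit.mpr hu⟩
      Matrix.vec_bijective
  obtain ⟨Z, hZ, huniq⟩ := hb.existsUnique B.vec
  simp only [kronCoeff_mulVec_vec, Matrix.vec_inj] at hZ huniq
  exact ⟨Z, hZ, huniq⟩

/-- Under the determinant condition the step equations can be solved recursively and uniquely. -/
theorem DetCondition.exists_steps {p : K[X]} {X₁ : Matrix (Fin k) (Fin k) K}
    (h : DetCondition p X₁) (d : ℕ) : ∃ X : ℕ → Matrix (Fin k) (Fin k) K, X 1 = X₁ ∧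
      ∀ s, 2 ≤ s → s ≤ d → ∀ Z, StepEquation p X s Z ↔ Z = X s := by
  induction d with
  | zero => exact ⟨fun _ => X₁, rfl, fun s h2 h0 => by omega⟩
  | succ d ih =>
    obtain ⟨X, hX1, hX⟩ := ih
    rcases Nat.lt_or_ge (d + 1) 2 with hd | hd
    · exact ⟨X, hX1, fun s h2 h0 => by omega⟩
    obtain ⟨Z₀, hZ₀, huniq⟩ := h.delta_existsUnique
      ((if d + 1 = 2 then 1 else 0) - stepRemainder p X (d + 1))
    have hne : ∀ t, t < d + 1 → Function.update X (d + 1) Z₀ t = X t := fun t ht =>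
      Function.update_of_ne ht.ne _ _
    refine ⟨Function.update X (d + 1) Z₀, by rw [hne 1 (by omega), hX1], fun s h2 hs Z => ?_⟩
    rw [stepEquation_iff p _ h2, stepRemainder_congr p (X' := X) h2
      (fun t _ ht => hne t (by omega)), hne 1 (by omega)]
    rcases Nat.lt_or_ge s (d + 1) with hs' | hs'
    · rw [hne s hs', ← hX s h2 (by omega) Z, stepEquation_iff p X h2]
    · obtain rfl : s = d + 1 := by omega
      rw [Function.update_self, hX1]
      exact ⟨huniq Z, fun hZ => hZ ▸ hZ₀⟩

end Step

/-! ### Companion matrices, traces and derivatives -/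

section Companion

variable {R : Type*} [CommRing R]

/-- The first unit row vector is cyclic for right multiplication by the companion matrix, which
shifts the unit vectors along the superdiagonal. -/
theorem companion_pow_row_zero (g : R[X]) (h0 : 0 < g.natDegree) (i : Fin g.natDegree) :
    (companion g ^ (i : ℕ)).row ⟨0, h0⟩ = Pi.single i 1 := by
  obtain ⟨i, hi⟩ := i
  induction i with
  | zero =>
    ext j
    simp [Matrix.one_apply, Pi.single_apply, eq_comm]
  | succ i ih =>
    have hrow : (companion g).row ⟨i, by omega⟩ = Pi.single ⟨i + 1, hi⟩ 1 := by
      ext j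
      have h1 : i + 1 ≠ g.natDegree := by omega
      simp [Matrix.row, companion, h1, Pi.single_apply, Fin.ext_iff]
    have : (companion g ^ (i + 1)).row ⟨0, h0⟩ =
        Matrix.vecMul ((companion g ^ i).row ⟨0, h0⟩) (companion g) := by
      rw [pow_succ]; rfl
    rw [this, ih (by omega), Matrix.single_one_vecMul, hrow]

/-- A monic polynomial annihilates its companion matrix. -/
theorem aeval_companion_self {g : R[X]} (hg : g.Monic) : aeval (companion g) g = 0 := by
  rcases Nat.eq_zero_or_pos g.natDegree with h0 | h0
  · ext i
    exact absurd i.2 (by omega)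
  set M := companion g with hM
  have hrow : (aeval M g).row ⟨0, h0⟩ = 0 := by
    have hk : (M ^ g.natDegree).row ⟨0, h0⟩ = fun j : Fin g.natDegree => -g.coeff j := by
      have h1 : (M ^ g.natDegree).row ⟨0, h0⟩ =
          Matrix.vecMul ((M ^ (g.natDegree - 1)).row ⟨0, h0⟩) M := by
        have : M ^ g.natDegree = M ^ (g.natDegree - 1) * M := by
          rw [← pow_succ, Nat.sub_add_cancel h0]
        rw [this]
        rfl
      have h2 := companion_pow_row_zero g h0 ⟨g.natDegree - 1, by omega⟩
      simp only at h2
      rw [h1, hM, h2, Matrix.single_one_vecMul]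
      ext j
      have h3 : g.natDegree - 1 + 1 = g.natDegree := by omega
      simp [Matrix.row, companion, h3]
    have hsum : (aeval M g).row ⟨0, h0⟩ =
        ∑ i ∈ Finset.range (g.natDegree + 1), g.coeff i • (M ^ i).row ⟨0, h0⟩ := by
      ext j
      rw [aeval_eq_sum_range]
      simp [Matrix.row, Matrix.sum_apply, Finset.sum_apply]
    rw [hsum, Finset.sum_range_succ, hk, hg.coeff_natDegree, one_smul,
      ← Fin.sum_univ_eq_sum_range (fun i => g.coeff i • (M ^ i).row ⟨0, h0⟩)]
    simp_rw [hM, companion_pow_row_zero g h0]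
    ext j
    simp [Finset.sum_apply, Pi.single_apply]
  -- Row `i` of `g(M)` is row `0` of `M ^ i * g(M)`, and the factors commute.
  have hall : ∀ i, (aeval M g).row i = 0 := by
    intro i
    have h1 : (M ^ (i : ℕ) * aeval M g).row ⟨0, h0⟩ = (aeval M g).row i := by
      have : (M ^ (i : ℕ) * aeval M g).row ⟨0, h0⟩ =
        Matrix.vecMul ((M ^ (i : ℕ)).row ⟨0, h0⟩) (aeval M g) := rfl
      rw [this, hM, companion_pow_row_zero, Matrix.single_one_vecMul]
    have h2 : M ^ (i : ℕ) * aeval M g = aeval M g * M ^ (i : ℕ) := by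
      rw [← aeval_X_pow (R := R) M, ← map_mul, ← map_mul, mul_comm]
    have h3 : (aeval M g * M ^ (i : ℕ)).row ⟨0, h0⟩ =
        Matrix.vecMul ((aeval M g).row ⟨0, h0⟩) (M ^ (i : ℕ)) := rfl
    rw [← h1, h2, h3, hrow, Matrix.zero_vecMul]
  ext i j
  exact congrFun (hall i) j

theorem aeval_derivative_eq_sum {A : Type*} [Ring A] [Algebra R A] (p : R[X]) (x : A) :
    aeval x (derivative p) =
      ∑ m ∈ Finset.Icc 1 p.natDegree, p.coeff m • ((m : A) * x ^ (m - 1)) := by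
  have h := derivative_apply p
  rw [sum_over_range _ (by simp), Finset.range_eq_Ico,
    Finset.sum_eq_sum_Ico_succ_bot (by omega)] at h
  rw [h, show Finset.Ico (0 + 1) (p.natDegree + 1) = Finset.Icc 1 p.natDegree by ext; simp]
  simp [map_sum, Algebra.smul_def, mul_assoc]

theorem delta_one {k : Type*} [Fintype k] [DecidableEq k] (p : R[X]) (M : Matrix k k R) :
    Delta p M M 1 = aeval M (derivative p) := by
  rw [Delta, aeval_derivative_eq_sum]
  refine Finset.sum_congr rfl fun m _ => ?_
  have h : ∀ i ∈ Finset.range m, M ^ (m - 1 - i) * 1 * M ^ i = M ^ (m - 1) := by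
    intro i hi
    rw [Finset.mem_range] at hi
    rw [mul_one, ← pow_add, show m - 1 - i + i = m - 1 by omega]
  rw [Finset.sum_congr rfl h, Finset.sum_const, Finset.card_range, nsmul_eq_mul]

/-- Cyclicity of the trace merges the powers on both sides of `Z`. This shows that `p'(M) ≠ 0` when
`Δp(M, M)(Z) = 1` in characteristic zero and positive size. -/
theorem trace_delta {k : Type*} [Fintype k] [DecidableEq k] (p : R[X]) (M Z : Matrix k k R) :
    (Delta p M M Z).trace = (aeval M (derivative p) * Z).trace := by
  rw [Delta, aeval_derivative_eq_sum, Finset.sum_mul, Matrix.trace_sum, Matrix.trace_sum]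
  refine Finset.sum_congr rfl fun m _ => ?_
  rw [smul_mul_assoc, Matrix.trace_smul, Matrix.trace_smul, Matrix.trace_sum]
  have h : ∀ i ∈ Finset.range m,
      (M ^ (m - 1 - i) * Z * M ^ i).trace = (M ^ (m - 1) * Z).trace := by
    intro i hi
    rw [Finset.mem_range] at hi
    rw [Matrix.trace_mul_comm, ← mul_assoc, ← pow_add, show i + (m - 1 - i) = m - 1 by omega]
  rw [Finset.sum_congr rfl h, Finset.sum_const, Finset.card_range, ← Matrix.trace_smul,
    nsmul_eq_mul, mul_assoc]

theorem coeff_zero_aeval {A : Type*} [Ring A] [Algebra R A] (p : R[X]) (F : PowerSeries A) :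
    PowerSeries.coeff 0 (aeval F p) = aeval (PowerSeries.coeff 0 F) p := by
  simp [aeval_eq_sum_range, map_sum]

theorem coeff_one_aeval {k : ℕ} (p : R[X]) (M : Matrix (Fin k) (Fin k) R) :
    PowerSeries.coeff 1 (aeval (PowerSeries.C M + PowerSeries.X) p) = aeval M (derivative p) := by
  have h : (PowerSeries.C M + PowerSeries.X : PowerSeries (Matrix (Fin k) (Fin k) R)) =
      PowerSeries.mk fun n =>
        (fun m : ℕ => if m = 1 then M else if m = 2 then 1 else 0) (n + 1) := by
    ext1 n
    rcases n with _ | _ | n <;> simp [PowerSeries.coeff_X]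
  have h1 := coeff_aeval_mk p (fun m : ℕ => if m = 1 then M else if m = 2 then 1 else 0) le_rfl
  rw [← h, stepRemainder_two, add_zero] at h1
  simp only [Nat.add_one_sub_one, if_true] at h1
  rw [h1]
  simp [delta_one]

end Companion

/-! ### Minimal polynomials of companion-Jordan blocks and of their direct sums -/

section Minpoly

variable {K : Type*} [Field K]

theorem minpoly_companion {g : K[X]} (hg : g.Monic) (hirr : Irreducible g) :
    minpoly K (companion g) = g := by
  have : Nonempty (Fin g.natDegree) := ⟨⟨0, hirr.natDegree_pos⟩⟩
  exact (minpoly.eq_of_irreducible_of_monic hirr (aeval_companion_self hg) hg).symm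

/-- With `C` the companion matrix, `g(C + ε) = ε U` since `g(C) = 0`, and the constant term of `U`
is `g'(C)`, invertible by separability. So `g ^ e` becomes `ε ^ e U ^ e` modulo `ε ^ d`: zero for `e
= d`, nonzero for `e = d - 1`. -/
theorem minpoly_companionJordanBlock [CharZero K] {g : K[X]} (hg : g.Monic) (hirr : Irreducible g)
    {d : ℕ} (hd : 0 < d) : minpoly K (companionJordanBlock d g) = g ^ d := by
  have : Nonempty (Fin g.natDegree) := ⟨⟨0, hirr.natDegree_pos⟩⟩
  set M := companion g
  set W : PowerSeries (Matrix (Fin g.natDegree) (Fin g.natDegree) K) :=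
    aeval (PowerSeries.C M + PowerSeries.X) g
  set U : PowerSeries (Matrix (Fin g.natDegree) (Fin g.natDegree) K) :=
    PowerSeries.mk fun n => PowerSeries.coeff (n + 1) W
  have hW0 : PowerSeries.coeff 0 W = 0 := by
    rw [coeff_zero_aeval]
    simpa using aeval_companion_self hg
  have hW : W = PowerSeries.X * U := by
    ext1 n
    rcases n with _ | n
    · rw [hW0, PowerSeries.coeff_zero_X_mul]
    · rw [PowerSeries.coeff_succ_X_mul, PowerSeries.coeff_mk]
  have hWe : ∀ e, W ^ e = PowerSeries.X ^ e * U ^ e := fun e => by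
    rw [hW, (PowerSeries.commute_X U).symm.mul_pow]
  have hpow : ∀ e, aeval (companionJordanBlock d g) (g ^ e) =
      toeplitz d (PowerSeries.X ^ e * U ^ e) := fun e => by
    rw [map_pow, companionJordanBlock_eq_toeplitz, aeval_algHom_apply, ← map_pow, ← hWe]
  have hzero : aeval (companionJordanBlock d g) (g ^ d) = 0 := by
    rw [hpow, ← map_zero (toeplitz d), toeplitz_eq_iff]
    intro i hi
    rw [PowerSeries.coeff_X_pow_mul', if_neg (by omega), map_zero]
  have hu : IsUnit (aeval M (derivative g)) := by
    obtain ⟨a, b, hab⟩ := hirr.separable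
    have h := congrArg (aeval M) hab
    rw [map_add, map_mul, map_mul, aeval_companion_self hg, mul_zero, zero_add, map_one] at h
    exact IsUnit.of_mul_eq_one_right _ h
  have hne : aeval (companionJordanBlock d g) (g ^ (d - 1)) ≠ 0 := by
    rw [hpow, ← map_zero (toeplitz d), Ne, toeplitz_eq_iff]
    intro h
    have h1 := h (d - 1) (by omega)
    rw [PowerSeries.coeff_X_pow_mul', if_pos le_rfl, Nat.sub_self, map_zero,
      PowerSeries.coeff_zero_eq_constantCoeff_apply, map_pow,
      ← PowerSeries.coeff_zero_eq_constantCoeff_apply, PowerSeries.coeff_mk, zero_add,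
      coeff_one_aeval] at h1
    exact (hu.pow (d - 1)).ne_zero h1
  obtain ⟨e, he, hass⟩ := (dvd_prime_pow hirr.prime d).mp (minpoly.dvd K _ hzero)
  have heq := eq_of_monic_of_associated (minpoly.monic (Matrix.isIntegral _)) (hg.pow e) hass
  rw [heq]
  rcases he.lt_or_eq with h | h
  · refine absurd ?_ hne
    apply (minpoly.dvd_iff (A := K)).mp
    rw [heq]
    exact pow_dvd_pow g (by omega)
  · rw [h]

theorem aeval_directSum {R : Type*} [CommRing R] {r n : ℕ} {d k : Fin r → ℕ}
    (h : ∑ j, d j * k j = n)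
    (B : ∀ j, Matrix (Fin (d j) × Fin (k j)) (Fin (d j) × Fin (k j)) R) (q : R[X]) :
    aeval (directSum h B) q = directSum h fun j => aeval (B j) q := by
  let φ : (∀ j, Matrix (Fin (d j) × Fin (k j)) (Fin (d j) × Fin (k j)) R) →ₐ[R]
      Matrix (Σ j, Fin (d j) × Fin (k j)) (Σ j, Fin (d j) × Fin (k j)) R :=
    { Matrix.blockDiagonal'RingHom (fun j => Fin (d j) × Fin (k j)) R with
      commutes' := fun a => by
        have : algebraMap R (∀ j, Matrix (Fin (d j) × Fin (k j)) (Fin (d j) × Fin (k j)) R) a =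
          a • 1 := Algebra.algebraMap_eq_smul_one a
        rw [this, Algebra.algebraMap_eq_smul_one]
        change Matrix.blockDiagonal' (a • 1) = _
        rw [Matrix.blockDiagonal'_smul, Matrix.blockDiagonal'_one] }
  have h1 : ∀ B, directSum h B = Matrix.reindexAlgEquiv R R (indexEquiv d k h) (φ B) := fun _ => rfl
  rw [h1, h1, aeval_algHom_apply, aeval_algHom_apply, aeval_pi_apply]

theorem directSum_eq_zero {R : Type*} [CommRing R] {r n : ℕ} {d k : Fin r → ℕ}
    (h : ∑ j, d j * k j = n)
    (B : ∀ j, Matrix (Fin (d j) × Fin (k j)) (Fin (d j) × Fin (k j)) R) :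
    directSum h B = 0 ↔ ∀ j, B j = 0 := by
  have h0 : directSum h (0 : ∀ j, Matrix (Fin (d j) × Fin (k j)) (Fin (d j) × Fin (k j)) R) = 0 := by
    rw [directSum, Matrix.blockDiagonal'_zero]
    rfl
  rw [← h0, directSum, directSum, EquivLike.apply_eq_iff_eq, Matrix.blockDiagonal'_inj, funext_iff]
  rfl

theorem minpoly_directSum [CharZero K] {r n : ℕ} {g : Fin r → K[X]} {d : Fin r → ℕ}
    (hmonic : ∀ j, (g j).Monic) (hirr : ∀ j, Irreducible (g j))
    (hcop : Pairwise (Function.onFun IsCoprime g)) (hd : ∀ j, 0 < d j)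
    (h : ∑ j, d j * (g j).natDegree = n) :
    minpoly K (directSum h fun j => companionJordanBlock (d j) (g j)) = ∏ j, g j ^ d j := by
  have hiff : ∀ q : K[X], minpoly K (directSum h fun j => companionJordanBlock (d j) (g j)) ∣ q ↔
      ∀ j, g j ^ d j ∣ q := by
    intro q
    rw [minpoly.dvd_iff, aeval_directSum, directSum_eq_zero]
    refine forall_congr' fun j => ?_
    rw [← minpoly_companionJordanBlock (hmonic j) (hirr j) (hd j), minpoly.dvd_iff]
  refine eq_of_monic_of_associated (minpoly.monic (Matrix.isIntegral _))
    (monic_prod_of_monic _ _ fun j _ => (hmonic j).pow _) (associated_of_dvd_dvd ?_ ?_)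
  · exact (hiff _).mpr fun j => Finset.dvd_prod_of_mem _ (Finset.mem_univ j)
  · exact Fintype.prod_dvd_of_coprime (fun i j hij => (hcop hij).pow) ((hiff _).mp dvd_rfl)

end Minpoly

/-! ### The determinant condition in terms of eigenvalues -/

section Condition

variable {K : Type*} [Field K] {k : ℕ}

theorem detCondition_iff_delta {p : K[X]} {M : Matrix (Fin k) (Fin k) K} :
    DetCondition p M ↔ ∀ Z, Delta p M M Z = 0 → Z = 0 := by
  rw [DetCondition, Ne, ← Matrix.exists_mulVec_eq_zero_iff]
  constructor
  · intro h Z hZ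
    by_contra hne
    exact h ⟨Z.vec, by rwa [Ne, Matrix.vec_eq_zero_iff], by
      rw [kronCoeff_mulVec_vec, hZ, Matrix.vec_zero]⟩
  · rintro h ⟨v, hv, hv0⟩
    obtain ⟨Z, rfl⟩ := Matrix.vec_bijective.surjective v
    rw [kronCoeff_mulVec_vec, Matrix.vec_eq_zero_iff] at hv0
    exact hv (by rw [h Z hv0, Matrix.vec_zero])

theorem DetCondition.aeval_derivative_ne_zero {p : K[X]} {M : Matrix (Fin k) (Fin k) K}
    [Nonempty (Fin k)] (h : DetCondition p M) : aeval M (derivative p) ≠ 0 := by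
  rw [← delta_one]
  exact fun h0 => one_ne_zero (detCondition_iff_delta.mp h 1 h0)

/-- The determinant condition is invariant under field extension. -/
theorem detCondition_map {L : Type*} [Field L] [Algebra K L] (p : K[X])
    (M : Matrix (Fin k) (Fin k) K) :
    DetCondition (p.map (algebraMap K L)) (M.map (algebraMap K L)) ↔ DetCondition p M := by
  have h : kronCoeff (p.map (algebraMap K L)) (M.map (algebraMap K L)) =
      (algebraMap K L).mapMatrix (kronCoeff p M) := by
    simp only [kronCoeff, natDegree_map, map_sum, coeff_map]
    refine Finset.sum_congr rfl fun m _ => ?_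
    have hmap : ∀ N : Matrix (Fin k × Fin k) (Fin k × Fin k) K,
      N.map (algebraMap K L) = (algebraMap K L).mapMatrix N := fun _ => rfl
    rw [RingHom.mapMatrix_apply, Matrix.map_smul' _ _ _ (map_mul (algebraMap K L)),
      hmap (Finset.sum _ _), map_sum]
    congr 1
    refine Finset.sum_congr rfl fun i _ => ?_
    ext a b
    have h1 : ∀ (N : Matrix (Fin k) (Fin k) K) (i : ℕ), N.map (algebraMap K L) ^ i =
      (N ^ i).map (algebraMap K L) := fun N i => (map_pow (algebraMap K L).mapMatrix N i).symm
    rw [← Matrix.transpose_map, h1, h1]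
    simp [Matrix.kroneckerMap_apply]
  rw [DetCondition, DetCondition, h, ← RingHom.map_det, Ne, Ne,
    map_eq_zero_iff _ (algebraMap K L).injective]

theorem mem_spectrum_iff_exists_mulVec {n : Type*} [Fintype n] [DecidableEq n] {M : Matrix n n K}
    {z : K} : z ∈ spectrum K M ↔ ∃ v, v ≠ 0 ∧ M.mulVec v = z • v := by
  rw [spectrum.mem_iff, Matrix.isUnit_iff_isUnit_det, isUnit_iff_ne_zero, not_not,
    ← Matrix.exists_mulVec_eq_zero_iff]
  refine exists_congr fun v => and_congr_right fun _ => ?_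
  rw [Matrix.sub_mulVec, sub_eq_zero, Algebra.algebraMap_eq_smul_one, Matrix.smul_mulVec,
    Matrix.one_mulVec, eq_comm]

theorem mem_spectrum_iff_exists_vecMul {n : Type*} [Fintype n] [DecidableEq n] {M : Matrix n n K}
    {z : K} : z ∈ spectrum K M ↔ ∃ v, v ≠ 0 ∧ M.vecMul v = z • v := by
  rw [spectrum.mem_iff, Matrix.isUnit_iff_isUnit_det, isUnit_iff_ne_zero, not_not,
    ← Matrix.exists_vecMul_eq_zero_iff]
  refine exists_congr fun v => and_congr_right fun _ => ?_
  rw [Matrix.vecMul_sub, sub_eq_zero, Algebra.algebraMap_eq_smul_one, Matrix.vecMul_smul,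
    Matrix.vecMul_one, eq_comm]

/-- `Δp` acts as a scalar on common eigenvectors of left and right multiplication. -/
theorem delta_of_eigen {p : K[X]} {M Z : Matrix (Fin k) (Fin k) K} {a b : K}
    (ha : M * Z = a • Z) (hb : Z * M = b • Z) :
    Delta p M M Z = (∑ m ∈ Finset.Icc 1 p.natDegree,
      p.coeff m * ∑ i ∈ Finset.range m, b ^ i * a ^ (m - 1 - i)) • Z := by
  have hapow : ∀ i : ℕ, M ^ i * Z = a ^ i • Z := by
    intro i
    induction i with
    | zero => simp
    | succ i ih => rw [pow_succ, mul_assoc, ha, mul_smul_comm, ih, smul_smul, pow_succ']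
  have hbpow : ∀ i : ℕ, Z * M ^ i = b ^ i • Z := by
    intro i
    induction i with
    | zero => simp
    | succ i ih => rw [pow_succ', ← mul_assoc, hb, smul_mul_assoc, ih, smul_smul, pow_succ']
  rw [Delta, Finset.sum_smul]
  refine Finset.sum_congr rfl fun m _ => ?_
  rw [mul_smul, Finset.sum_smul]
  congr 1
  refine Finset.sum_congr rfl fun i _ => ?_
  rw [hapow, smul_mul_assoc, hbpow, smul_smul, mul_comm]

/-- Together with the right-hand version, this makes the kernel of `Δp(M, M)` invariant under both
multiplications by `M`. -/
theorem delta_mul_left (p : K[X]) (M Z : Matrix (Fin k) (Fin k) K) :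
    Delta p M M (M * Z) = M * Delta p M M Z := by
  simp only [Delta, Finset.mul_sum, mul_smul_comm]
  refine Finset.sum_congr rfl fun m _ => congrArg _ (Finset.sum_congr rfl fun i _ => ?_)
  rw [← mul_assoc, ← mul_assoc, ← mul_assoc, ← pow_succ, ← pow_succ']

theorem delta_mul_right (p : K[X]) (M Z : Matrix (Fin k) (Fin k) K) :
    Delta p M M (Z * M) = Delta p M M Z * M := by
  simp only [Delta, Finset.sum_mul, smul_mul_assoc]
  refine Finset.sum_congr rfl fun m _ => congrArg _ (Finset.sum_congr rfl fun i _ => ?_)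
  rw [mul_assoc, mul_assoc, mul_assoc, mul_assoc, ← pow_succ, ← pow_succ']

/-- `Δp(M, M)` as a linear map. -/
def deltaLin (p : K[X]) (M : Matrix (Fin k) (Fin k) K) :
    Module.End K (Matrix (Fin k) (Fin k) K) where
  toFun := Delta p M M
  map_add' Y Z := by
    simp only [Delta, mul_add, add_mul, Finset.sum_add_distrib, smul_add]
  map_smul' a Z := by
    simp only [Delta, mul_smul_comm, smul_mul_assoc, ← Finset.smul_sum, RingHom.id_apply,
      smul_comm _ a]

/-- Two commuting endomorphisms have a common eigenvector in an invariant subspace. -/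
theorem exists_common_eigenvector [IsAlgClosed K] {V : Type*} [AddCommGroup V] [Module K V]
    [FiniteDimensional K V] {f g : Module.End K V} (hfg : Commute f g) {W : Submodule K V}
    (hW : W ≠ ⊥) (hf : ∀ x ∈ W, f x ∈ W) (hg : ∀ x ∈ W, g x ∈ W) :
    ∃ x ∈ W, x ≠ 0 ∧ ∃ a b : K, f x = a • x ∧ g x = b • x := by
  have key : ∀ (f : Module.End K V) (W : Submodule K V), W ≠ ⊥ → (∀ x ∈ W, f x ∈ W) →
      ∃ a : K, ∃ x ∈ W, x ≠ 0 ∧ f x = a • x := by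
    intro f W hW hf
    have : Nontrivial W := Submodule.nontrivial_iff_ne_bot.mpr hW
    obtain ⟨a, ha⟩ := Module.End.exists_eigenvalue (f.restrict hf)
    obtain ⟨x, hx⟩ := ha.exists_hasEigenvector
    refine ⟨a, x, x.2, fun h => hx.2 (Subtype.ext h), ?_⟩
    exact congrArg Subtype.val hx.apply_eq_smul
  obtain ⟨a, x, hx, hx0, hax⟩ := key f W hW hf
  have hmem : ∀ y, y ∈ W ⊓ f.eigenspace a ↔ y ∈ W ∧ f y = a • y := fun y => by
    rw [Submodule.mem_inf, Module.End.mem_eigenspace_iff]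
  obtain ⟨b, y, hy, hy0, hby⟩ := key g (W ⊓ f.eigenspace a)
    (fun h => hx0 (by
      have := (hmem x).mpr ⟨hx, hax⟩
      rwa [h, Submodule.mem_bot] at this))
    (fun y hy => by
      rw [hmem] at hy ⊢
      refine ⟨hg y hy.1, ?_⟩
      have : f (g y) = g (f y) := LinearMap.congr_fun hfg.eq y
      rw [this, hy.2, map_smul])
  exact ⟨y, ((hmem y).mp hy).1, hy0, a, b, ((hmem y).mp hy).2, hby⟩

/-- Over an algebraically closed field the determinant condition is a condition on eigenvalues. -/
theorem detCondition_iff_spectrum [IsAlgClosed K] {p : K[X]} {M : Matrix (Fin k) (Fin k) K} :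
    DetCondition p M ↔ ∀ a ∈ spectrum K M, ∀ b ∈ spectrum K M,
      ∑ m ∈ Finset.Icc 1 p.natDegree,
        p.coeff m * ∑ i ∈ Finset.range m, a ^ i * b ^ (m - 1 - i) ≠ 0 := by
  constructor
  · intro h b hb a ha h0
    obtain ⟨u, hu, hMu⟩ := mem_spectrum_iff_exists_mulVec.mp ha
    obtain ⟨w, hw, hMw⟩ := mem_spectrum_iff_exists_vecMul.mp hb
    -- The product of a right and a left eigenvector is an eigenvector of `Δp(M, M)`, here with
    -- eigenvalue zero.
    have hZ := detCondition_iff_delta.mp h (Matrix.vecMulVec u w) (by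
      rw [delta_of_eigen (a := a) (b := b), h0, zero_smul]
      · rw [Matrix.mul_vecMulVec, hMu, Matrix.smul_vecMulVec]
      · rw [Matrix.vecMulVec_mul, hMw, Matrix.vecMulVec_smul])
    rw [Matrix.vecMulVec_eq_zero] at hZ
    exact hZ.elim hu hw
  · intro h
    by_contra hdet
    rw [detCondition_iff_delta] at hdet
    push Not at hdet
    obtain ⟨Z, hZ, hZ0⟩ := hdet
    -- A nonzero kernel contains a common eigenvector `Y` of both multiplications; a nonzero column
    -- and a nonzero row of `Y` show that `a` and `b` are eigenvalues of `M`.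
    obtain ⟨Y, hY, hY0, a, b, ha, hb⟩ := exists_common_eigenvector
      (f := LinearMap.mulLeft K M) (g := LinearMap.mulRight K M)
      (LinearMap.commute_mulLeft_right M M)
      (W := LinearMap.ker (deltaLin p M)) (fun hbot => hZ0 (by
        have : Z ∈ LinearMap.ker (deltaLin p M) := hZ
        rwa [hbot, Submodule.mem_bot] at this))
      (fun x hx => by
        change Delta p M M (M * x) = 0
        rw [delta_mul_left, show Delta p M M x = 0 from hx, mul_zero])
      (fun x hx => by
        change Delta p M M (x * M) = 0
        rw [delta_mul_right, show Delta p M M x = 0 from hx, zero_mul])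
    rw [LinearMap.mulLeft_apply] at ha
    rw [LinearMap.mulRight_apply] at hb
    obtain ⟨i, j, hij⟩ : ∃ i j, Y i j ≠ 0 := by
      by_contra! h0
      exact hY0 (Matrix.ext h0)
    have haS : a ∈ spectrum K M := mem_spectrum_iff_exists_mulVec.mpr
      ⟨Y.col j, fun h0 => hij (congrFun h0 i), by
        ext l
        exact congrFun (congrFun ha l) j⟩
    have hbS : b ∈ spectrum K M := mem_spectrum_iff_exists_vecMul.mpr
      ⟨Y.row i, fun h0 => hij (congrFun h0 j), by
        ext l
        exact congrFun (congrFun hb i) l⟩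
    have hd : Delta p M M Y = 0 := hY
    rw [delta_of_eigen ha hb] at hd
    exact (smul_eq_zero.mp hd).elim (h b hbS a haS) hY0

end Condition

theorem detCondition_iff_eigenvalueCondition {H : Subfield ℂ} {k : ℕ} (p : H[X])
    (M : Matrix (Fin k) (Fin k) H) : DetCondition p M ↔ EigenvalueCondition p M := by
  rw [← detCondition_map (L := ℂ), detCondition_iff_spectrum, EigenvalueCondition]
  simp only [natDegree_map, coeff_map]
  rfl

/-! ### Counting solutions in quotient rings -/

section Counting

variable {K : Type*} [Field K]

/-- Solutions of `p(ξ) = x` correspond to solutions in the range of an injective algebra map. -/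
theorem encard_solutions_range {A B : Type*} [Ring A] [Ring B] [Algebra K A] [Algebra K B]
    (φ : A →ₐ[K] B) (hφ : Function.Injective φ) (p : K[X]) (x : A) :
    {b : B | b ∈ φ.range ∧ aeval b p = φ x}.encard = {a : A | aeval a p = x}.encard := by
  rw [← hφ.encard_image]
  congr 1
  ext b
  constructor
  · rintro ⟨⟨a, rfl⟩, h⟩
    change aeval (φ a) p = φ x at h
    rw [aeval_algHom_apply] at h
    exact ⟨a, hφ h, rfl⟩
  · rintro ⟨a, ha, rfl⟩
    have ha : aeval a p = x := ha
    exact ⟨⟨a, rfl⟩, by rw [aeval_algHom_apply, ha]⟩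

/-- The quotient by the minimal polynomial embeds as the algebra generated by a matrix. -/
theorem exists_adjoinRoot_algHom {n : Type*} [Fintype n] [DecidableEq n] (M : Matrix n n K) :
    ∃ φ : AdjoinRoot (minpoly K M) →ₐ[K] Matrix n n K,
      Function.Injective φ ∧ φ (AdjoinRoot.root _) = M := by
  have h : ∀ q ∈ Ideal.span {minpoly K M}, aeval M q = 0 := fun q hq =>
    minpoly.dvd_iff.mp (Ideal.mem_span_singleton.mp hq)
  let φ : AdjoinRoot (minpoly K M) →ₐ[K] Matrix n n K := Ideal.Quotient.liftₐ _ (aeval M) h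
  have hmk : ∀ q : K[X], φ (AdjoinRoot.mk _ q) = aeval M q := fun _ => rfl
  refine ⟨φ, ?_, ?_⟩
  · rw [injective_iff_map_eq_zero]
    intro x hx
    obtain ⟨q, rfl⟩ := AdjoinRoot.mk_surjective x
    rw [hmk] at hx
    exact AdjoinRoot.mk_eq_zero.mpr (minpoly.dvd K M hx)
  · rw [AdjoinRoot.root, hmk, aeval_X]

theorem commute_of_aeval_eq {A : Type*} [Ring A] [Algebra K A] {p : K[X]} {X M : A}
    (h : aeval X p = M) : Commute X M := by
  have h1 := congrArg (aeval X) (mul_comm Polynomial.X p)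
  rwa [map_mul, map_mul, aeval_X, h] at h1

/-- Matrix solutions of `p(X) = M` correspond to solutions modulo the minimal polynomial. -/
theorem encard_matrix_solutions [Infinite K] {n : Type*} [Fintype n] [DecidableEq n]
    {M : Matrix n n K} (hM : (minpoly K M).natDegree = Fintype.card n) (p : K[X]) :
    {X : Matrix n n K | aeval X p = M}.encard =
      {ξ : AdjoinRoot (minpoly K M) | aeval ξ p = AdjoinRoot.root _}.encard := by
  obtain ⟨φ, hφ, hroot⟩ := exists_adjoinRoot_algHom M
  rw [← encard_solutions_range φ hφ, hroot]
  congr 1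
  ext X
  refine ⟨fun h => ⟨?_, h⟩, fun h => h.2⟩
  obtain ⟨q, rfl⟩ := exists_aeval_eq_of_commute hM (commute_of_aeval_eq h)
  exact ⟨aeval (AdjoinRoot.root _) q, by
    change φ _ = _
    rw [← aeval_algHom_apply, hroot]⟩

/-- Lifting of solutions along a surjection onto a field with nil kernel. -/
theorem encard_solutions_of_nil_ker {S L : Type*} [CommRing S] [Field L] [Algebra K S]
    [Algebra K L] (π : S →ₐ[K] L) (hπ : Function.Surjective π)
    (hnil : ∀ s, π s = 0 → IsNilpotent s) (p : K[X]) (x : S)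
    (hder : ∀ η : L, aeval η p = π x → aeval η (derivative p) ≠ 0) :
    {ξ : S | aeval ξ p = x}.encard = {η : L | aeval η p = π x}.encard := by
  -- For `t` lifting the inverse of `π s`, the product `s * t` is one plus a nilpotent.
  have hunit : ∀ s, π s ≠ 0 → IsUnit s := by
    intro s hs
    obtain ⟨t, ht⟩ := hπ (π s)⁻¹
    have h1 : IsNilpotent (s * t - 1) := hnil _ (by
      rw [map_sub, map_mul, ht, mul_inv_cancel₀ hs, map_one, sub_self])
    have h2 := h1.isUnit_add_one
    rw [sub_add_cancel] at h2
    exact isUnit_of_mul_isUnit_left h2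
  set P : S[X] := p.map (algebraMap K S) - C x
  have hP : ∀ s : S, aeval s P = aeval s p - x := fun s => by
    simp [P, aeval_map_algebraMap]
  have hP' : ∀ s : S, aeval s (derivative P) = aeval s (derivative p) := fun s => by
    simp [P, derivative_map, aeval_map_algebraMap]
  have hu : ∀ s, aeval (π s) p = π x → IsUnit (aeval s (derivative P)) := fun s hs => by
    rw [hP']
    apply hunit
    rw [← aeval_algHom_apply]
    exact hder _ hs
  have hmap : ∀ s, aeval s p = x → aeval (π s) p = π x := fun s hs => by
    rw [aeval_algHom_apply, hs]
  have hinj : Set.InjOn π {ξ : S | aeval ξ p = x} := by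
    intro a ha b hb hab
    have ha : aeval a p = x := ha
    have hb : aeval b p = x := hb
    have hPa : aeval a P = 0 := by rw [hP, ha, sub_self]
    have hPb : aeval b P = 0 := by rw [hP, hb, sub_self]
    refine (existsUnique_nilpotent_sub_and_aeval_eq_zero (P := P) (x := a)
      (by rw [hPa]; exact IsNilpotent.zero) (hu a (hmap a ha))).unique
      ⟨by rw [sub_self]; exact IsNilpotent.zero, hPa⟩
      ⟨hnil _ (by rw [map_sub, hab, sub_self]), hPb⟩
  rw [← hinj.encard_image]
  congr 1
  ext η
  constructor
  · rintro ⟨s, hs, rfl⟩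
    exact hmap s hs
  · intro hη
    have hη : aeval η p = π x := hη
    -- Any lift of `η` is a root up to a nilpotent with invertible derivative, so Newton's method
    -- corrects it.
    obtain ⟨s, rfl⟩ := hπ η
    obtain ⟨r, ⟨hr, hr0⟩, -⟩ := existsUnique_nilpotent_sub_and_aeval_eq_zero (P := P) (x := s)
      (hnil _ (by rw [hP, map_sub, ← aeval_algHom_apply, hη, sub_self])) (hu s hη)
    refine ⟨r, by rwa [hP, sub_eq_zero] at hr0, ?_⟩
    have := (hr.map π).eq_zero
    rw [map_sub, sub_eq_zero] at this
    exact this.symm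

theorem algHomOfDvd_mk {f g : K[X]} (h : g ∣ f) (q : K[X]) :
    AdjoinRoot.algHomOfDvd K f g h (AdjoinRoot.mk f q) = AdjoinRoot.mk g q := by
  rw [← AdjoinRoot.aeval_eq, ← AdjoinRoot.aeval_eq, ← aeval_algHom_apply]
  simp

theorem algHomOfDvd_root {f g : K[X]} (h : g ∣ f) :
    AdjoinRoot.algHomOfDvd K f g h (AdjoinRoot.root f) = AdjoinRoot.root g :=
  algHomOfDvd_mk h X

theorem encard_solutions_pow {g : K[X]} (hirr : Irreducible g) {d : ℕ} (hd : 0 < d) (p : K[X])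
    (hder : ∀ η : AdjoinRoot g, aeval η p = AdjoinRoot.root g → aeval η (derivative p) ≠ 0) :
    {ξ : AdjoinRoot (g ^ d) | aeval ξ p = AdjoinRoot.root _}.encard =
      {η : AdjoinRoot g | aeval η p = AdjoinRoot.root g}.encard := by
  have : Fact (Irreducible g) := ⟨hirr⟩
  have hdvd : g ∣ g ^ d := dvd_pow_self g hd.ne'
  have h := encard_solutions_of_nil_ker (AdjoinRoot.algHomOfDvd K (g ^ d) g hdvd)
    (fun y => by
      obtain ⟨q, rfl⟩ := AdjoinRoot.mk_surjective y
      exact ⟨_, algHomOfDvd_mk hdvd q⟩)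
    (fun s hs => by
      obtain ⟨q, rfl⟩ := AdjoinRoot.mk_surjective s
      rw [algHomOfDvd_mk, AdjoinRoot.mk_eq_zero] at hs
      exact ⟨d, by rw [← map_pow, AdjoinRoot.mk_eq_zero]; exact pow_dvd_pow_of_dvd hs d⟩)
    p (AdjoinRoot.root _) (by rwa [algHomOfDvd_root])
  rwa [algHomOfDvd_root] at h

/-- The Chinese remainder theorem for the number of solutions. -/
theorem encard_solutions_prod {r : ℕ} (f : Fin r → K[X])
    (hcop : Pairwise (Function.onFun IsCoprime f)) (p : K[X]) :
    {ξ : AdjoinRoot (∏ j, f j) | aeval ξ p = AdjoinRoot.root _}.encard =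
      ∏ j, {ξ : AdjoinRoot (f j) | aeval ξ p = AdjoinRoot.root (f j)}.encard := by
  have hdvd : ∀ j, f j ∣ ∏ j, f j := fun j => Finset.dvd_prod_of_mem _ (Finset.mem_univ j)
  let Φ : AdjoinRoot (∏ j, f j) →ₐ[K] ∀ j, AdjoinRoot (f j) :=
    AlgHom.pi fun j => AdjoinRoot.algHomOfDvd K _ (f j) (hdvd j)
  have hmk : ∀ q j, Φ (AdjoinRoot.mk _ q) j = AdjoinRoot.mk (f j) q := fun q j =>
    algHomOfDvd_mk (hdvd j) q
  have hinj : Function.Injective Φ := by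
    rw [injective_iff_map_eq_zero]
    intro x hx
    obtain ⟨q, rfl⟩ := AdjoinRoot.mk_surjective x
    rw [AdjoinRoot.mk_eq_zero]
    refine Fintype.prod_dvd_of_coprime hcop fun j => ?_
    rw [← AdjoinRoot.mk_eq_zero, ← hmk, hx]
    rfl
  have hsurj : Function.Surjective Φ := by
    intro y
    obtain ⟨q, hq⟩ := Ideal.pi_quotient_surjective (I := fun j => Ideal.span {f j})
      (fun i j hij => (Ideal.isCoprime_span_singleton_iff _ _).mpr (hcop hij)) y
    exact ⟨AdjoinRoot.mk _ q, funext fun j => (hmk q j).trans (hq j)⟩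
  rw [← encard_solutions_range Φ hinj, ← Set.encard_pi_eq_prod_encard]
  congr 1
  ext y
  have hroot : ∀ j, Φ (AdjoinRoot.root _) j = AdjoinRoot.root (f j) := fun j => hmk X j
  simp only [Set.mem_ofPred_eq, Set.mem_pi, Set.mem_univ, true_implies, funext_iff, hroot,
    aeval_pi_apply₂]
  exact ⟨fun h => h.2, fun h => ⟨hsurj y, h⟩⟩

end Counting

/-- `g` is the minimal polynomial of `z`, so `H[x]/(g)` embeds in `ℂ` with image `H(z)` and its root
goes to `z`. -/
theorem encard_scalarSolutions {H : Subfield ℂ} {g : H[X]} (hg : g.Monic) (hirr : Irreducible g)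
    (p : H[X]) {z : ℂ} (hz : aeval z g = 0) :
    {η : AdjoinRoot g | aeval η p = AdjoinRoot.root g}.encard = (scalarSolutions p z).encard := by
  obtain rfl := minpoly.eq_of_irreducible_of_monic hirr hz hg
  have hint : IsIntegral H z := ⟨_, hg, hz⟩
  let e := IntermediateField.adjoinRootEquivAdjoin H hint
  let φ : AdjoinRoot (minpoly H z) →ₐ[H] ℂ := H⟮z⟯.val.comp e.toAlgHom
  have hroot : φ (AdjoinRoot.root _) = z := by
    change ((e (AdjoinRoot.root _) : H⟮z⟯) : ℂ) = z
    rw [IntermediateField.adjoinRootEquivAdjoin_apply_root]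
    rfl
  rw [← encard_solutions_range φ (Subtype.val_injective.comp e.injective), hroot]
  congr 1
  ext μ
  refine and_congr_left fun _ => ⟨?_, fun h => ?_⟩
  · rintro ⟨a, rfl⟩
    exact (e a).2
  · obtain ⟨a, ha⟩ := e.surjective ⟨μ, h⟩
    exact ⟨a, congrArg Subtype.val ha⟩

theorem aeval_conj_inv {K n : Type*} [Field K] [Fintype n] [DecidableEq n] {T : Matrix n n K}
    (hT : IsUnit T) (Y : Matrix n n K) (p : K[X]) :
    aeval (T⁻¹ * Y * T) p = T⁻¹ * aeval Y p * T := by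
  obtain ⟨u, rfl⟩ := hT
  rw [← Matrix.coe_units_inv, aeval_eq_sum_range, aeval_eq_sum_range, Finset.mul_sum,
    Finset.sum_mul]
  refine Finset.sum_congr rfl fun i _ => ?_
  rw [Units.conj_pow', mul_smul_comm, smul_mul_assoc]

/-! ### Companion equations and lifting under the determinant condition -/

section Companion

variable {K : Type*} [Field K] {g : K[X]}

theorem natDegree_minpoly_companion (hg : g.Monic) (hirr : Irreducible g) :
    (minpoly K (companion g)).natDegree = Fintype.card (Fin g.natDegree) := by
  rw [minpoly_companion hg hirr, Fintype.card_fin]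

theorem encard_companion_solutions [Infinite K] (hg : g.Monic) (hirr : Irreducible g) (p : K[X]) :
    {X : Matrix (Fin g.natDegree) (Fin g.natDegree) K | aeval X p = companion g}.encard =
      {η : AdjoinRoot g | aeval η p = AdjoinRoot.root g}.encard := by
  have h := encard_matrix_solutions (natDegree_minpoly_companion hg hirr) p
  rwa [minpoly_companion hg hirr] at h

/-- A root `η` with `p'(η) = 0` would map to a matrix solution `M` with `p'(M) = 0`, contradicting
the determinant condition. For `d = 1` there is nothing to lift. -/
theorem encard_solutions_pow_of_detCondition (hg : g.Monic) (hirr : Irreducible g) {d : ℕ}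
    (hd : 0 < d) (p : K[X])
    (hdet : 1 < d → ∀ M : Matrix (Fin g.natDegree) (Fin g.natDegree) K,
      aeval M p = companion g → DetCondition p M) :
    {ξ : AdjoinRoot (g ^ d) | aeval ξ p = AdjoinRoot.root _}.encard =
      {η : AdjoinRoot g | aeval η p = AdjoinRoot.root g}.encard := by
  rcases Nat.lt_or_ge 1 d with h1 | h1
  · refine encard_solutions_pow hirr hd p fun η hη h0 => ?_
    obtain ⟨φ, -, hroot⟩ := exists_adjoinRoot_algHom (companion g)
    revert φ
    rw [minpoly_companion hg hirr]
    intro φ hroot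
    have : Nonempty (Fin g.natDegree) := ⟨⟨0, hirr.natDegree_pos⟩⟩
    refine (hdet h1 (φ η) (by rw [aeval_algHom_apply, hη, hroot])).aeval_derivative_ne_zero ?_
    rw [aeval_algHom_apply, h0, map_zero]
  · obtain rfl : d = 1 := by omega
    rw [pow_one]

end Companion

theorem aeval_eq_zero_of_mem_spectrum {H : Subfield ℂ} {k : ℕ} {M : Matrix (Fin k) (Fin k) H}
    {h : H[X]} (hM : aeval M h = 0) {μ : ℂ} (hμ : μ ∈ spectrum ℂ (M.map (algebraMap H ℂ))) :
    aeval μ h = 0 := by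
  have h1 : aeval (M.map (algebraMap H ℂ)) (h.map (algebraMap H ℂ)) = 0 := by
    have h2 : aeval ((Algebra.ofId H ℂ).mapMatrix M) h = 0 := by
      rw [aeval_algHom_apply, hM, map_zero]
    rw [aeval_map_algebraMap]
    exact h2
  have h3 := spectrum.subset_polynomial_aeval (M.map (algebraMap H ℂ)) (h.map (algebraMap H ℂ))
    ⟨μ, hμ, rfl⟩
  rw [h1, spectrum.mem_iff, sub_zero] at h3
  by_contra hne
  simp only [eval_map_algebraMap] at h3
  exact h3 ((isUnit_iff_ne_zero.mpr hne).map (algebraMap ℂ _))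

/-- If `Δp(M, M)(Z) = 1` is solvable, where `p(M)` is the companion matrix of an irreducible
polynomial, then the determinant condition holds for `M`. -/
theorem detCondition_of_delta_eq_one {H : Subfield ℂ} {g : H[X]} (hg : g.Monic)
    (hirr : Irreducible g) {p : H[X]} {M Z : Matrix (Fin g.natDegree) (Fin g.natDegree) H}
    (hM : aeval M p = companion g) (hZ : Delta p M M Z = 1) : DetCondition p M := by
  -- Otherwise the trace of `Δp(M, M)(Z) = 1` would be zero, but it is the positive size of the
  -- matrix.
  have hder : aeval M (derivative p) ≠ 0 := by
    intro h0
    have h1 := trace_delta p M Z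
    rw [hZ, h0, zero_mul, Matrix.trace_one, Matrix.trace_zero, Fintype.card_fin] at h1
    exact hirr.natDegree_pos.ne' (by exact_mod_cast h1)
  obtain ⟨q, hq⟩ := exists_aeval_eq_of_commute (natDegree_minpoly_companion hg hirr)
    (commute_of_aeval_eq hM)
  -- `M = q(C)` lies in the field generated by the companion matrix `C = p(M)`, so `p'(M) ≠ 0` is
  -- invertible there; the Bézout coefficient `b` gives the inverse as `b(p(M))`.
  have hcop : IsCoprime g ((derivative p).comp q) := by
    refine (hirr.coprime_iff_not_dvd).mpr fun hdvd => hder ?_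
    rw [← hq, ← aeval_comp, ← minpoly.dvd_iff, minpoly_companion hg hirr]
    exact hdvd
  obtain ⟨a, b, hab⟩ := hcop
  have hunit : aeval M (b.comp p * derivative p - 1) = 0 := by
    have h1 := congrArg (aeval (companion g)) hab
    rw [map_add, map_mul, map_mul, aeval_companion_self hg, mul_zero, zero_add, map_one,
      aeval_comp, hq] at h1
    rw [map_sub, map_mul, aeval_comp, hM, h1, map_one, sub_self]
  have hinv : aeval M (q.comp p - X) = 0 := by
    rw [map_sub, aeval_comp, hM, hq, aeval_X, sub_self]
  rw [detCondition_iff_eigenvalueCondition]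
  intro μ hμ ν hν h0
  -- On the diagonal the sum is `p'(μ)`, nonzero by `hunit`. Off it, the sum times `μ - ν` is `p(μ)
  -- - p(ν)`, nonzero because `q` inverts `p` on the spectrum by `hinv`.
  by_cases hne : μ = ν
  · subst hne
    have h1 := aeval_eq_zero_of_mem_spectrum hunit hμ
    have h2 : aeval μ (derivative p) = 0 := by
      rw [aeval_derivative_eq_sum, ← h0]
      refine Finset.sum_congr rfl fun m _ => ?_
      have h3 : ∀ i ∈ Finset.range m, μ ^ i * μ ^ (m - 1 - i) = μ ^ (m - 1) := by
        intro i hi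
        rw [Finset.mem_range] at hi
        rw [← pow_add, show i + (m - 1 - i) = m - 1 by omega]
      rw [Finset.sum_congr rfl h3, Finset.sum_const, Finset.card_range, nsmul_eq_mul]
      rfl
    rw [map_sub, map_mul, h2, mul_zero, map_one, zero_sub, neg_eq_zero] at h1
    exact one_ne_zero h1
  · have h1 := aeval_eq_zero_of_mem_spectrum hinv hμ
    have h2 := aeval_eq_zero_of_mem_spectrum hinv hν
    rw [map_sub, aeval_comp, aeval_X, sub_eq_zero] at h1 h2
    have h3 : aeval μ p = aeval ν p := by
      rw [← sub_eq_zero, aeval_eq_sum_range, aeval_eq_sum_range, ← Finset.sum_sub_distrib,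
        Finset.range_eq_Ico, Finset.sum_eq_sum_Ico_succ_bot (by omega)]
      rw [show Finset.Ico (0 + 1) (p.natDegree + 1) = Finset.Icc 1 p.natDegree by ext; simp,
        pow_zero, pow_zero, sub_self, zero_add, ← zero_mul (μ - ν), ← h0, Finset.sum_mul]
      refine Finset.sum_congr rfl fun m _ => ?_
      rw [mul_assoc, geom_sum₂_mul, mul_sub]
      rfl
    exact hne (by rw [← h1, h3, h2])

/-- Since `X` commutes with `A`, it is `q(A)`, and `p(q(x)) - x` is divisible by the minimal
polynomial. Evaluation at `z` gives the solution `q(z)`. -/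
theorem scalarSolutions_nonempty_of_solution {H : Subfield ℂ} {n : ℕ}
    {A X : Matrix (Fin n) (Fin n) H} (hA : (minpoly H A).natDegree = n) {p g : H[X]}
    (hX : aeval X p = A) (hg : g ∣ minpoly H A) {z : ℂ} (hz : aeval z g = 0) :
    (scalarSolutions p z).Nonempty := by
  obtain ⟨q, hq⟩ := exists_aeval_eq_of_commute (by rw [hA, Fintype.card_fin])
    (commute_of_aeval_eq hX)
  have h1 : minpoly H A ∣ p.comp q - Polynomial.X := minpoly.dvd H A (by
    rw [map_sub, aeval_comp, hq, hX, aeval_X, sub_self])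
  obtain ⟨c, hc⟩ := hg.trans h1
  have h2 := congrArg (aeval z) hc
  rw [map_sub, map_mul, hz, zero_mul, aeval_comp, aeval_X, sub_eq_zero] at h2
  exact ⟨aeval z q, IntermediateField.algebra_adjoin_le_adjoin H {z}
    (aeval_mem_adjoin_singleton H z), h2⟩

theorem Nonderogatory.minpoly_eq_charpoly {H : Subfield ℂ} {n : ℕ} {A : Matrix (Fin n) (Fin n) H}
    (hA : Nonderogatory A) : minpoly H A = A.charpoly :=
  (eq_of_monic_of_dvd_of_natDegree_le (minpoly.monic (Matrix.isIntegral A)) A.charpoly_monic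
    (Matrix.minpoly_dvd_charpoly A) (by
      rw [hA.natDegree_minpoly, Matrix.charpoly_natDegree_eq_dim, Fintype.card_fin])).symm

end PolyMatEq

end

/-! ### The main theorem -/

open PolyMatEq
theorem mainTheorem1 (H : Subfield ℂ) (n : ℕ) (A : Matrix (Fin n) (Fin n) H)
    (hA : Nonderogatory A) (r : ℕ) (g : Fin r → H[X]) (d : Fin r → ℕ)
    (hmonic : ∀ j, (g j).Monic) (hirr : ∀ j, Irreducible (g j))
    (hcop : Pairwise (Function.onFun IsCoprime g)) (hd : ∀ j, 0 < d j)
    (hchar : A.charpoly = ∏ j, g j ^ d j) (p : H[X]) :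
    -- existence of the companion-Jordan form
    (∃ T : Matrix (Fin n) (Fin n) H, IsUnit T ∧
      A = T⁻¹ * directSum (size_eq hmonic hchar)
        (fun j => companionJordanBlock (d j) (g j)) * T) ∧
    -- the determinant condition and the eigenvalue condition are equivalent
    (∀ j, ∀ X₁ : Matrix (Fin (g j).natDegree) (Fin (g j).natDegree) H,
      aeval X₁ p = companion (g j) → (DetCondition p X₁ ↔ EigenvalueCondition p X₁)) ∧
    -- (i)
    ((∃ X : Matrix (Fin n) (Fin n) H, aeval X p = A) →
      ∀ j, ∀ z : ℂ, aeval z (g j) = 0 → (scalarSolutions p z).Nonempty) ∧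
    -- (ii)
    ((∀ j, ∀ z : ℂ, aeval z (g j) = 0 → (scalarSolutions p z).Nonempty) →
      ∀ j, ∃ X₁ : Matrix (Fin (g j).natDegree) (Fin (g j).natDegree) H,
        aeval X₁ p = companion (g j)) ∧
    (∀ j, ∀ z : ℂ, aeval z (g j) = 0 →
      {X₁ : Matrix (Fin (g j).natDegree) (Fin (g j).natDegree) H |
        aeval X₁ p = companion (g j)}.encard = (scalarSolutions p z).encard) ∧
    -- (iii)
    ((∀ j, ∀ z : ℂ, aeval z (g j) = 0 → (scalarSolutions p z).Nonempty) →
      (∀ j, 1 < d j → ∃ X₁ : Matrix (Fin (g j).natDegree) (Fin (g j).natDegree) H,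
        aeval X₁ p = companion (g j) ∧ DetCondition p X₁) →
      (∃ X₁ : ∀ j, Matrix (Fin (g j).natDegree) (Fin (g j).natDegree) H,
        ∀ j, aeval (X₁ j) p = companion (g j) ∧ (1 < d j → DetCondition p (X₁ j))) ∧
      ∀ X₁ : ∀ j, Matrix (Fin (g j).natDegree) (Fin (g j).natDegree) H,
        (∀ j, aeval (X₁ j) p = companion (g j) ∧ (1 < d j → DetCondition p (X₁ j))) →
        ∃ X : ∀ j, ℕ → Matrix (Fin (g j).natDegree) (Fin (g j).natDegree) H,
          (∀ j, X j 1 = X₁ j) ∧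
          (∀ j, ∀ s, 2 ≤ s → s ≤ d j → ∀ Z, StepEquation p (X j) s Z ↔ Z = X j s) ∧
          ∀ T : Matrix (Fin n) (Fin n) H, IsUnit T →
            A = T⁻¹ * directSum (size_eq hmonic hchar)
              (fun j => companionJordanBlock (d j) (g j)) * T →
            aeval (T⁻¹ * directSum (size_eq hmonic hchar)
              (fun j => blockToeplitz (d j) (X j)) * T) p = A) ∧
    -- (iv)
    ((∀ j, 1 < d j → ∀ X₁ : Matrix (Fin (g j).natDegree) (Fin (g j).natDegree) H,
        aeval X₁ p = companion (g j) → DetCondition p X₁) →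
      ∀ z : Fin r → ℂ, (∀ j, aeval (z j) (g j) = 0) →
        {X : Matrix (Fin n) (Fin n) H | aeval X p = A}.encard =
          ∏ j, (scalarSolutions p (z j)).encard) ∧
    -- (v)
    (∀ X : ∀ j, ℕ → Matrix (Fin (g j).natDegree) (Fin (g j).natDegree) H,
      (∀ j, aeval (X j 1) p = companion (g j)) →
      (∀ j, ∀ s, 2 ≤ s → s ≤ d j → StepEquation p (X j) s (X j s)) →
      (∀ T : Matrix (Fin n) (Fin n) H, IsUnit T →
        A = T⁻¹ * directSum (size_eq hmonic hchar)
          (fun j => companionJordanBlock (d j) (g j)) * T →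
        aeval (T⁻¹ * directSum (size_eq hmonic hchar)
          (fun j => blockToeplitz (d j) (X j)) * T) p = A) ∧
      ((∃ j, 1 < d j ∧ ¬ DetCondition p (X j 1)) →
        {X' : Matrix (Fin n) (Fin n) H | aeval X' p = A}.Infinite)) := by
  have hdeg := hA.natDegree_minpoly
  have hmin : minpoly H A = ∏ j, g j ^ d j := hA.minpoly_eq_charpoly.trans hchar
  have hcount : ∀ j, ∀ z : ℂ, aeval z (g j) = 0 →
      {X₁ : Matrix (Fin (g j).natDegree) (Fin (g j).natDegree) H |
        aeval X₁ p = companion (g j)}.encard = (scalarSolutions p z).encard := fun j z hz => by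
    rw [encard_companion_solutions (hmonic j) (hirr j),
      encard_scalarSolutions (hmonic j) (hirr j) p hz]
  have hexists : (∀ j, ∀ z : ℂ, aeval z (g j) = 0 → (scalarSolutions p z).Nonempty) →
      ∀ j, ∃ X₁ : Matrix (Fin (g j).natDegree) (Fin (g j).natDegree) H,
        aeval X₁ p = companion (g j) := by
    intro h j
    obtain ⟨z, hz⟩ := IsAlgClosed.exists_aeval_eq_zero ℂ (g j) (hirr j).degree_pos.ne'
    have h1 := Set.encard_ne_zero.mpr (h j z hz)
    rw [← hcount j z hz] at h1
    exact Set.encard_ne_zero.mp h1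
  have hsolve : ∀ X : ∀ j, ℕ → Matrix (Fin (g j).natDegree) (Fin (g j).natDegree) H,
      (∀ j, aeval (X j 1) p = companion (g j)) →
      (∀ j, ∀ s, 2 ≤ s → s ≤ d j → StepEquation p (X j) s (X j s)) →
      ∀ T : Matrix (Fin n) (Fin n) H, IsUnit T →
        A = T⁻¹ * directSum (size_eq hmonic hchar)
          (fun j => companionJordanBlock (d j) (g j)) * T →
        aeval (T⁻¹ * directSum (size_eq hmonic hchar)
          (fun j => blockToeplitz (d j) (X j)) * T) p = A := by
    intro X h1 hX T hT hAT
    rw [aeval_conj_inv hT, aeval_directSum]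
    conv_rhs => rw [hAT]
    simp_rw [fun j => aeval_blockToeplitz (h1 j) (hX j)]
  refine ⟨?_, fun j X₁ _ => detCondition_iff_eigenvalueCondition p X₁, ?_, hexists, hcount,
    ?_, ?_, ?_⟩
  · refine exists_similar_of_minpoly_eq (by rw [hdeg, Fintype.card_fin]) ?_
    rw [hmin, minpoly_directSum hmonic hirr hcop hd]
  · rintro ⟨X, hX⟩ j z hz
    refine scalarSolutions_nonempty_of_solution hdeg hX ?_ hz
    rw [hmin]
    exact (dvd_pow_self _ (hd j).ne').trans (Finset.dvd_prod_of_mem _ (Finset.mem_univ j))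
  · intro hsc hdet
    constructor
    · have : ∀ j, ∃ X₁ : Matrix (Fin (g j).natDegree) (Fin (g j).natDegree) H,
          aeval X₁ p = companion (g j) ∧ (1 < d j → DetCondition p X₁) := by
        intro j
        by_cases h1 : 1 < d j
        · obtain ⟨X₁, hX₁, hD⟩ := hdet j h1
          exact ⟨X₁, hX₁, fun _ => hD⟩
        · obtain ⟨X₁, hX₁⟩ := hexists hsc j
          exact ⟨X₁, hX₁, fun h => absurd h h1⟩
      choose X₁ hX₁ using this
      exact ⟨X₁, hX₁⟩
    · intro X₁ hX₁
      have : ∀ j, ∃ X : ℕ → Matrix (Fin (g j).natDegree) (Fin (g j).natDegree) H,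
          X 1 = X₁ j ∧ ∀ s, 2 ≤ s → s ≤ d j → ∀ Z, StepEquation p X s Z ↔ Z = X s := by
        intro j
        by_cases h1 : 1 < d j
        · exact ((hX₁ j).2 h1).exists_steps (d j)
        · exact ⟨fun _ => X₁ j, rfl, fun s h2 hs => by omega⟩
      choose X hX1 hX using this
      exact ⟨X, hX1, hX, hsolve X (fun j => by rw [hX1, (hX₁ j).1])
        fun j s h2 hs => (hX j s h2 hs _).mpr rfl⟩
  · intro hdet z hz
    have h1 := encard_matrix_solutions (M := A) (by rw [hdeg, Fintype.card_fin]) p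
    rw [hmin] at h1
    rw [h1, encard_solutions_prod _ fun i j hij => (hcop hij).pow]
    refine Finset.prod_congr rfl fun j _ => ?_
    rw [encard_solutions_pow_of_detCondition (hmonic j) (hirr j) (hd j) p (hdet j),
      encard_scalarSolutions (hmonic j) (hirr j) p (hz j)]
  · intro X h1 hX
    refine ⟨hsolve X h1 hX, ?_⟩
    rintro ⟨j, hj, hdet⟩
    -- As `d j > 1`, the equation for the second block is available and forces the determinant
    -- condition, so its assumed failure is contradictory.
    have h2 := hX j 2 le_rfl hj
    rw [StepEquation, if_pos rfl] at h2
    exact absurd (detCondition_of_delta_eq_one (hmonic j) (hirr j) (h1 j) h2) hdet
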